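/- **Setting.** Let \(a,b>0\), \(a_1=a\), \(a_2=ib\), \(a_3=-a\), \(a_4=-ib\). Let \(\Delta_i\) be the segment joining \(a_i\) and \(0\), oriented towards \(0\), and \(\Delta=\bigcup_i\Delta_i\). Let \(w(z)=\sqrt{(z^2-a^2)(z^2+b^2)}\) be the branch holomorphic in \(\mathbb C\setminus\Delta\) with \(w(z)\sim z^2\) at infinity, and \(w_+\) its trace on the left of \(\Delta_i\). *Weight.* Let \(\rho\) be a weight on \(\Delta\) of class \(\mathcal W_1\): its restriction to \(\Delta_i\) is \(\rho_i(s)=\rho_i^*(s)(s-a_i)^{\alpha_i}\) with \(\rho_i^*\) holomorphic and non-vanishing in a neighborhood of \(\Delta_i\), \(\alpha_i>-1\), and a branch of the power holomorphic across \(\Delta\setminus\{a_i\}\); the ratio \(\rho_1\rho_3/(\rho_2\rho_4)\) is constant near \(0\); and \(\sum_i\rho_i(0)=0\). Choose branches of \(\log\rho_i\), continuous on \(\Delta_i\setminus\{a_i\}\), such that \(\nu:=\frac1{2\pi i}\sum_{i=1}^4(-1)^i\log\rho_i(0)\) satisfies \(\mathrm{Re}\,\nu\in(-\frac12,\frac12]\).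 On \(\Delta_i\) let \(\log w_+=\log|w_+|+i\vartheta_i\) with \((\vartheta_1,\vartheta_2,\vartheta_3,\vartheta_4)=(-\frac\pi2,\frac\pi2,\frac{3\pi}2,\frac\pi2)\), and let \(\log(\rho w_+)=\log\rho_i+\log w_+\). *Surface.* Let \(\mathfrak R\) be the compact Riemann surface of \(w\), with sheets \(\mathfrak R^{(0)}\) (where \(w(\mathbf z)=w(z)\)) and \(\mathfrak R^{(1)}\) (where \(w(\mathbf z)=-w(z)\)), points \(z^{(k)}\) over \(z\), and sheet involution \(\mathbf z\mapsto\mathbf z^*\). Let \(\boldsymbol\alpha\) and \(\boldsymbol\beta\) be the cycles over the segments \([a_4,a_1]\) and \([a_2,a_1]\), oriented towards \(a_1\) on \(\mathfrak R^{(0)}\), and let \(\boldsymbol\Delta\) be the preimage of \(\Delta\), oriented so that \(\mathfrak R^{(0)}\) lies on its left. Put \[\Omega=\Big(\oint_{\boldsymbol\alpha}\frac{ds}{w(\mathbf s)}\Big)^{-1}\frac{dz}{w(\mathbf z)},\quad \mathsf B=\oint_{\boldsymbol\beta}\Omega,\quad \mathsf K_+=\frac{1+\mathsf B}4,\quad \Phi(\mathbf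 z)=\exp\int_{\boldsymbol a_3}^{\mathbf z}\frac{z\,dz}{w(\mathbf z)},\quad c_\rho=\frac1{2\pi i}\oint_{\boldsymbol\Delta}\log(\rho w_+)\,\Omega,\] where paths from the ramification point \(\boldsymbol a_3\) stay in \(\mathfrak R\setminus(\boldsymbol\alpha\cup\boldsymbol\beta)\) (values on the cycles being traces), and let \([s]\) be the class of \(s\) modulo \(\mathbb Z+\mathsf B\mathbb Z\). Let \[S_\rho(\mathbf z)=\exp\Big\{-\frac1{4\pi i}\oint_{\boldsymbol\Delta}\log(\rho w_+)\,\Omega_{\mathbf z,\mathbf z^*}\Big\},\] where \(\Omega_{\mathbf z,\mathbf z^*}\) is the differential with simple poles at \(\mathbf z,\mathbf z^*\), residues \(1,-1\), and zero \(\boldsymbol\alpha\)-period. For \(k\in\{0,1\}\), let \(\mathbf z_k\in\mathfrak R\) and \(l_k,m_k\in\mathbb Z\) be given by \[\int_{\boldsymbol a_3}^{\mathbf z_k}\Omega=c_\rho-(-1)^k\mathsf K_++l_k+m_k\mathsf B\] (when \(\mathbf z_k\) lies on \(\boldsymbol\alpha\cup\boldsymbol\beta\), the trace of \(\Phi\)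 at \(\mathbf z_k\) is taken from the same side as that of the integral). *Indices.* Let \(\boldsymbol 0,\boldsymbol 0^*\) be the points over \(0\) with \(w(\boldsymbol 0)=iab\), \(w(\boldsymbol 0^*)=-iab\). Put \(\varsigma=1\), \(\boldsymbol o=\boldsymbol 0\), \(A_\rho=e^{\pi i\nu}\rho_3(0)\frac{(\rho_2+\rho_3)(0)}{\rho_2(0)}\) if \(\mathrm{Re}\,\nu>0\), and \(\varsigma=-1\), \(\boldsymbol o=\boldsymbol 0^*\), \(A_\rho=\frac1{(ab)^2}\frac{(\rho_3+\rho_4)(0)}{(\rho_3\rho_4)(0)}\) if \(\mathrm{Re}\,\nu<0\). For \(n\ge1\), with \(k=n\bmod 2\), let \(A_{\rho,n}=0\) if \(\mathrm{Re}\,\nu=0\), and otherwise \[A_{\rho,n}=(-1)^{l_k+m_k+k}A'_{\rho,n}\,\Phi(\mathbf z_k)\,\Phi(\boldsymbol o)^{2(n-1)},\] \[A'_{\rho,n}=A_\rho\,e^{\pi i\varsigma(c_\rho+1/4)}\,\frac{\sqrt{a^2+b^2}}2\,\frac{\Gamma(1-\varsigma\nu)}{\sqrt{2\pi}}\Big[\lim_{z\to0,\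 \arg z=5\pi/4}|z|^{2\nu}S_\rho^2(z^{(0)})\Big]^{\varsigma}\Big(\frac{ab}{2n}\Big)^{1/2-\varsigma\nu}.\] For \(\varepsilon\in(0,\frac12)\) let \[\mathbb N_{\rho,\varepsilon}=\{n\ge1:\ \mathbf z_{n\bmod 2}\ne\infty^{(0)}\ \text{and}\ |1-A_{\rho,n}|\ge\varepsilon\}.\] **Proposition.** For every \(\varepsilon\in(0,\frac12)\) the set \(\mathbb N_{\rho,\varepsilon}\) is non-empty, and the following holds. 1. If \([c_\rho]=[0]\), then \(\mathbb N_{\rho,\varepsilon}\) is the set of all even \(n\ge1\). If \([c_\rho]=[(1+\mathsf B)/2]\), then \(\mathbb N_{\rho,\varepsilon}\) is the set of all odd \(n\ge1\). 2. If \([c_\rho]\) is neither of these classes and \(|\mathrm{Re}\,\nu|<\frac12\), then \(\mathbb N_{\rho,\varepsilon}\) contains all sufficiently large \(n\); if, moreover, \(\mathrm{Re}\,\nu=0\), then \(\mathbb N_{\rho,\varepsilon}=\{1,2,3,\dots\}\). 3. If \([c_\rho]\) is neither of these classes and \(\mathrm{Re}\,\nu=\frac12\), then \(\mathbb N_{\rho,\varepsilon}\)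 is infinite. If, moreover, \(\varepsilon<\frac{2ab}{a^2+b^2}\), then its gaps eventually have size at most \(2\): there is \(n_0\) such that among any three consecutive integers \(n,n+1,n+2\) with \(n\ge n_0\) at least one belongs to \(\mathbb N_{\rho,\varepsilon}\). -/

import Mathlib

open Complex Filter Topology Set

noncomputable section

namespace CrossOP

/-- The endpoints `a₁ = a`, `a₂ = ib`, `a₃ = -a`, `a₄ = -ib` of the cross. The index `i : Fin 4`
stands for the mathematical index `i + 1`. -/
def corner (a b : ℝ) : Fin 4 → ℂ := ![(a : ℂ), I * b, -(a : ℂ), -(I * b)]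

/-- The closed segment `Δ_i` joining `a_i` and the origin. -/
def arm (a b : ℝ) (i : Fin 4) : Set ℂ := segment ℝ (corner a b i) 0

/-- The cross `Δ = [-a,a] ∪ [-ib,ib]`. -/
def cross (a b : ℝ) : Set ℂ := ⋃ i, arm a b i

/-- The class `W_ℓ` of weights. `ρ i` is the restriction of the weight to `Δ_i` together with its
holomorphic extension to a neighborhood of `Δ_i ∖ {a_i}`; `exp (α * L z)` is a branch of
`(z - a_i) ^ α` holomorphic across `Δ ∖ {a_i}`. -/
structure IsWeight (a b : ℝ) (ℓ : ℕ∞) (ρ : Fin 4 → ℂ → ℂ) : Prop where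
  factor : ∀ i, ∃ (α : ℝ) (g L : ℂ → ℂ), -1 < α ∧
    AnalyticOnNhd ℂ g (arm a b i) ∧ (∀ z ∈ arm a b i, g z ≠ 0) ∧
    AnalyticOnNhd ℂ L (cross a b \ {corner a b i}) ∧
    (∀ z ∈ cross a b \ {corner a b i}, ∀ᶠ x in 𝓝 z, exp (L x) = x - corner a b i) ∧
    (∀ z ∈ arm a b i \ {corner a b i}, ∀ᶠ x in 𝓝 z, ρ i x = g x * exp (α * L x))
  ratio : ∃ C : ℂ, ∀ᶠ z in 𝓝 (0 : ℂ), (ρ 0 z * ρ 2 z) / (ρ 1 z * ρ 3 z) = C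
  sum_zero : ρ 0 0 + ρ 1 0 + ρ 2 0 + ρ 3 0 = 0
  match_zero : ∀ l : ℕ, (l : ℕ∞) < ℓ → ∀ i j,
    iteratedDeriv l (ρ i) 0 / ρ i 0 = iteratedDeriv l (ρ j) 0 / ρ j 0

/-- `ν = (2πi)⁻¹ ∑ (-1)^i log ρ_i(0)` for the branches `lg i` of `log ρ_i`. -/
def nu (lg : Fin 4 → ℂ → ℂ) : ℂ :=
  1 / (2 * Real.pi * I) * ∑ i : Fin 4, (-1) ^ (i.val + 1) * lg i 0

/-- `lg i` is a branch of `log ρ_i` continuous on `Δ_i ∖ {a_i}`, and the branches are selected so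
that `Re ν ∈ (-1/2, 1/2]`. -/
structure IsLogChoice (a b : ℝ) (ρ lg : Fin 4 → ℂ → ℂ) : Prop where
  cont : ∀ i, ContinuousOn (lg i) (arm a b i \ {corner a b i})
  exp_eq : ∀ i, ∀ s ∈ arm a b i \ {corner a b i}, exp (lg i s) = ρ i s
  nu_mem : (nu lg).re ∈ Ioc (-(1 / 2) : ℝ) (1 / 2)

/-- The branch of `√((z²-a²)(z²+b²))`, holomorphic off the cross, with `w(z) ~ z²` at infinity
(the powers `1/2` are principal: their cuts are exactly the two segments of the cross). -/
def w (a b : ℝ) (z : ℂ) : ℂ :=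
  z ^ 2 * (1 - (a : ℂ) ^ 2 / z ^ 2) ^ (1 / 2 : ℂ) * (1 + (b : ℂ) ^ 2 / z ^ 2) ^ (1 / 2 : ℂ)

/-- The trace `w₊` on `Δ_i` from the left of `Δ_i`, when `Δ_i` is oriented towards the origin (so
that its direction is `-a_i` and its left normal is `I * (-a_i)`). -/
def wPlus (a b : ℝ) (i : Fin 4) (s : ℂ) : ℂ :=
  limUnder (𝓝[>] (0 : ℝ)) fun δ => w a b (s + δ * (I * (-corner a b i)))

/-- The branch of `log w₊` on `Δ_i`. As `w₊ = (-1)^i i |w₊|`, the argument on `Δ_i` is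
`(-1)^i π/2` modulo `2π`; the value `3π/2` is taken on `Δ_3`, so that the alternating sum
`∑ (-1)^i log w₊|_{Δ_i} (0)` vanishes and `∑ (-1)^i log (ρ_i w₊)(0) = 2πi ν`. -/
def logWPlus (a b : ℝ) (i : Fin 4) (s : ℂ) : ℂ :=
  (Real.log ‖wPlus a b i s‖ : ℂ) +
    (![-(1 / 2), 1 / 2, 3 / 2, 1 / 2] : Fin 4 → ℂ) i * (Real.pi * I)

/-- The cut `π(𝛂)`: the segment joining `a₄` and `a₁` (in the fourth quadrant). -/
def alphaArc (a b : ℝ) : Set ℂ := segment ℝ (corner a b 3) (corner a b 0)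

/-- The cut `π(𝛃)`: the segment joining `a₂` and `a₁` (in the first quadrant). -/
def betaArc (a b : ℝ) : Set ℂ := segment ℝ (corner a b 1) (corner a b 0)

/-- `∮ f(s) ds/w(s)` over the involution-symmetric cycle lying over the segment from `p` to `q`,
traversed from `p` to `q` on the sheet `0` and back on the sheet `1`, for a function `f` of the
projection. As `w` changes its sign on the sheet `1`, both halves contribute equally. -/
def cycleIntegral (a b : ℝ) (p q : ℂ) (f : ℂ → ℂ) : ℂ :=
  2 * ∫ t in (0 : ℝ)..1, f (p + t * (q - p)) / w a b (p + t * (q - p)) * (q - p)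

/-- `∮_𝛂 f(s) ds/w(s)`. -/
def alphaIntegral (a b : ℝ) (f : ℂ → ℂ) : ℂ := cycleIntegral a b (corner a b 3) (corner a b 0) f

/-- `∮_𝛃 f(s) ds/w(s)`. -/
def betaIntegral (a b : ℝ) (f : ℂ → ℂ) : ℂ := cycleIntegral a b (corner a b 1) (corner a b 0) f

/-- The period `∮_𝛂 ds/w(s)`, by which `dz/w` is divided to obtain `Ω`. -/
def alphaPeriod (a b : ℝ) : ℂ := alphaIntegral a b fun _ => 1

/-- `B = ∮_𝛃 Ω`. -/
def B (a b : ℝ) : ℂ := betaIntegral a b (fun _ => 1) / alphaPeriod a b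

/-- `K₊ = (1 + B) / 4`. -/
def Kplus (a b : ℝ) : ℂ := (1 + B a b) / 4

/-- Equality `[s] = [t]` of classes in the Jacobi variety `ℂ / (ℤ + B ℤ)`. -/
def JacEq (a b : ℝ) (s t : ℂ) : Prop := ∃ l m : ℤ, s = t + l + B a b * m

/-- `∮_𝚫 f(s) ds/w(s)` over the curve `𝚫 = π⁻¹(Δ)`, oriented so that the sheet `0` lies on its
left, for functions `f i` of the projection on `Δ_i`. The part over `Δ_i` is traversed towards the
origin with `w = w₊` and back with `w = -w₊`, so that both halves contribute equally. -/
def crossIntegral (a b : ℝ) (f : Fin 4 → ℂ → ℂ) : ℂ :=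
  ∑ i : Fin 4, 2 * ∫ t in (0 : ℝ)..1,
    f i ((1 - t) * corner a b i) / wPlus a b i ((1 - t) * corner a b i) * (-corner a b i)

/-- `c_ρ = (2πi)⁻¹ ∮_𝚫 log(ρ w₊) Ω`. -/
def crho (a b : ℝ) (lg : Fin 4 → ℂ → ℂ) : ℂ :=
  1 / (2 * Real.pi * I) *
    crossIntegral a b fun i s => (lg i s + logWPlus a b i s) / alphaPeriod a b

/-- The Szegő function `S_ρ(z⁽⁰⁾) = exp (-(4πi)⁻¹ ∮_𝚫 log(ρ w₊) Ω_{z,z*})` at the point of the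
sheet `0` over a finite `z`, where
`Ω_{z,z*} = w(z)/(s-z) ds/w(s) - (∮_𝛂 w(z)/(t-z) dt/w(t)) Ω` is the differential with simple poles
at `z`, `z*`, of residues `1`, `-1`, and with zero period on `𝛂`. -/
def szego (a b : ℝ) (lg : Fin 4 → ℂ → ℂ) (z : ℂ) : ℂ :=
  exp (-(1 / (4 * Real.pi * I)) * crossIntegral a b fun i s =>
    (lg i s + logWPlus a b i s) *
      (w a b z / (s - z) - alphaIntegral a b (fun t => w a b z / (t - z)) / alphaPeriod a b))

/-- The Riemann surface `ℜ` of `w`: the affine curve `y² = (z²-a²)(z²+b²)` (with `y = w(z)` on the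
sheet `0` and `y = -w(z)` on the sheet `1`) with two points `∞⁽⁰⁾`, `∞⁽¹⁾` added. -/
inductive Surface (a b : ℝ) : Type
  | affine (z y : ℂ) (h : y ^ 2 = (z ^ 2 - (a : ℂ) ^ 2) * (z ^ 2 + (b : ℂ) ^ 2)) : Surface a b
  | infty (k : Fin 2) : Surface a b

/-- The ramification point over `a₃ = -a`. -/
def ramification3 (a b : ℝ) : Surface a b := .affine (-(a : ℂ)) 0 (by ring)

/-- The point over `0` with `y = iab`, approached on the sheet `0` from the first and the third
quadrants. -/
def zeroPt (a b : ℝ) : Surface a b := .affine 0 (I * a * b) (by ring_nf; simp)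

/-- The other point over `0`, the image of `zeroPt` under the involution. -/
def zeroPtStar (a b : ℝ) : Surface a b := .affine 0 (-(I * a * b)) (by ring_nf; simp)

/-- `(z(t), y(t))` converges in `ℜ` to the given point as `t → 1⁻`. -/
def ConvergesTo {a b : ℝ} (z y : ℝ → ℂ) : Surface a b → Prop
  | .affine z₀ y₀ _ => Tendsto z (𝓝[<] 1) (𝓝 z₀) ∧ Tendsto y (𝓝[<] 1) (𝓝 y₀)
  | .infty k => Tendsto z (𝓝[<] 1) (Bornology.cobounded ℂ) ∧
      Tendsto (fun t => y t / z t ^ 2) (𝓝[<] 1) (𝓝 ((-1) ^ k.val))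

/-- There is a path `t ↦ (z(t), y(t))` on `ℜ` from `𝐚₃` to `p`, contained for `0 < t < 1` in
`ℜ ∖ (𝛂 ∪ 𝛃)` without `𝐚₃` and the points at infinity, such that along this path `u = ∫ Ω` and
`φ = Φ(p) = exp (∫ G)`, with `Ω = (∮_𝛂 ds/w)⁻¹ dz/w` and `G = z dz/w`. Here `U` and `V` are the
integrals of `Ω` and `G` along the path up to the time `t`. At `p = ∞⁽⁰⁾`, the pole of `Φ`, there
is no condition on `φ`. If `p` lies on `𝛂 ∪ 𝛃`, then `u` and `φ` are traces from one and the same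
side. -/
def IsLift {a b : ℝ} (p : Surface a b) (u φ : ℂ) : Prop :=
  ∃ z y U V : ℝ → ℂ,
    ContinuousOn z (Ico 0 1) ∧ ContinuousOn y (Ico 0 1) ∧
    ContinuousOn U (Ico 0 1) ∧ ContinuousOn V (Ico 0 1) ∧
    z 0 = -(a : ℂ) ∧ y 0 = 0 ∧ U 0 = 0 ∧ V 0 = 0 ∧
    (∀ t ∈ Ioo (0 : ℝ) 1,
      y t ^ 2 = (z t ^ 2 - (a : ℂ) ^ 2) * (z t ^ 2 + (b : ℂ) ^ 2) ∧ y t ≠ 0 ∧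
      z t ∉ alphaArc a b ∪ betaArc a b ∧
      DifferentiableAt ℝ z t ∧
      HasDerivAt U ((alphaPeriod a b)⁻¹ * (deriv z t / y t)) t ∧
      HasDerivAt V (z t * deriv z t / y t) t) ∧
    ConvergesTo z y p ∧
    Tendsto U (𝓝[<] 1) (𝓝 u) ∧
    (p ≠ .infty 0 → Tendsto (fun t => exp (V t)) (𝓝[<] 1) (𝓝 φ))

open Classical in
/-- `Φ(p) = exp (∫_{𝐚₃}^p G)`. -/
def Phi {a b : ℝ} (p : Surface a b) : ℂ :=
  if h : ∃ φ, ∃ u, IsLift p u φ then h.choose else 1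

/-- A point `pt` of `ℜ` with the value `phi = Φ(pt)` and two integers. -/
structure ThetaZero (a b : ℝ) where
  pt : Surface a b
  phi : ℂ
  l : ℤ
  m : ℤ

/-- The equation `∫_{𝐚₃}^{𝐳_k} Ω = c - (-1)^k K₊ + l_k + m_k B`. -/
def ThetaZero.Spec {a b : ℝ} (c : ℂ) (k : ℕ) (d : ThetaZero a b) : Prop :=
  IsLift d.pt (c - (-1) ^ k * Kplus a b + d.l + d.m * B a b) d.phi

open Classical in
/-- The point `𝐳_k` together with `Φ(𝐳_k)`, `l_k`, `m_k`. By Jacobi inversion the first case below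
always takes place. -/
def thetaZero (a b : ℝ) (c : ℂ) (k : ℕ) : ThetaZero a b :=
  if h : ∃ d : ThetaZero a b, d.Spec c k then h.choose else ⟨ramification3 a b, 1, 0, 0⟩

/-- `ς_ν`, used for `Re ν ≠ 0` only. -/
def varsigma (ν : ℂ) : ℤ := if 0 < ν.re then 1 else -1

/-- The point `𝐨`, used for `Re ν ≠ 0` only. -/
def originPt (a b : ℝ) (ν : ℂ) : Surface a b := if 0 < ν.re then zeroPt a b else zeroPtStar a b

/-- The constant `A_ρ`. -/
def Aconst (a b : ℝ) (ρ : Fin 4 → ℂ → ℂ) (ν : ℂ) : ℂ :=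
  if 0 < ν.re then exp (Real.pi * I * ν) * ρ 2 0 * ((ρ 1 0 + ρ 2 0) / ρ 1 0)
  else 1 / ((a : ℂ) * b) ^ 2 * ((ρ 2 0 + ρ 3 0) / (ρ 2 0 * ρ 3 0))

/-- `lim |z|^{2ν} S_ρ²(z⁽⁰⁾)` as `z → 0` along `arg z = 5π/4`. -/
def szegoLimit (a b : ℝ) (lg : Fin 4 → ℂ → ℂ) : ℂ :=
  limUnder (𝓝[>] (0 : ℝ)) fun r =>
    (r : ℂ) ^ (2 * nu lg) * szego a b lg (r * exp (5 * Real.pi / 4 * I)) ^ 2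

/-- The constants `A'_{ρ,n}`, for `n ≥ 1` and `Re ν ≠ 0`. -/
def Aprime (a b : ℝ) (ρ lg : Fin 4 → ℂ → ℂ) (n : ℕ) : ℂ :=
  Aconst a b ρ (nu lg) *
    exp (Real.pi * I * varsigma (nu lg) * (crho a b lg + 1 / 4)) *
    ((Real.sqrt (a ^ 2 + b ^ 2) : ℂ) / 2) *
    (Complex.Gamma (1 - varsigma (nu lg) * nu lg) / (Real.sqrt (2 * Real.pi) : ℂ)) *
    szegoLimit a b lg ^ varsigma (nu lg) *
    (((a * b / (2 * n) : ℝ) : ℂ) ^ (1 / 2 - varsigma (nu lg) * nu lg))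

/-- The constants `A_{ρ,n}`, for `n ≥ 1`, with `σ_k = (-1)^{l_k + m_k + k}`, `k = n mod 2`. -/
def A (a b : ℝ) (ρ lg : Fin 4 → ℂ → ℂ) (n : ℕ) : ℂ :=
  if (nu lg).re = 0 then 0
  else
    let d := thetaZero a b (crho a b lg) (n % 2)
    (-1) ^ (d.l + d.m + ((n % 2 : ℕ) : ℤ)) * Aprime a b ρ lg n * d.phi *
      Phi (originPt a b (nu lg)) ^ (2 * (n - 1))

/-- The set `ℕ_{ρ,ε}` of admissible indices `n ≥ 1`. -/
def admissible (a b : ℝ) (ρ lg : Fin 4 → ℂ → ℂ) (ε : ℝ) : Set ℕ :=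
  {n | 1 ≤ n ∧ (thetaZero a b (crho a b lg) (n % 2)).pt ≠ .infty 0 ∧ ε ≤ ‖1 - A a b ρ lg n‖}

end CrossOP

end

/-! Two questions decide everything: when is `𝐳_k` the point `∞⁽⁰⁾`, and how close to 1 is
`A_{ρ,n}`.

The curve y² = (z² - a²)(z² + b²) is uniformized by `elZ` = -a/cn and its derivative `elY`. By
`IsCurvePath.eq_elZ`, a path from `𝐚₃` is at every time the image of its integral of dz/y. So the
integral alone tells whether a path ends at infinity, and the parity of the indices of the pole
tells on which sheet. With P = `quarter a b` and Q = `quarter b a`, the poles are (2m+1)P + 2nQi,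
lying over `∞⁽⁰⁾` exactly for m + n odd. The periods of dz/w are 2(Qi - P) and -2(Qi + P)
(`alphaPeriod_eq_quarter`, `betaIntegral_one`), so K₊ corresponds to -P, and the points `∞⁽⁰⁾`,
`∞⁽¹⁾` have the distinct classes of K₊ and -K₊. Hence `𝐳_k = ∞⁽⁰⁾` exactly when [c_ρ] = [((-1)^k +
1)K₊], which is [0] for odd n and [(1+B)/2] for even n. In these two cases the other parity leads to
`∞⁽¹⁾`, the zero of Φ, so A = 0 and the index is admissible.

In the remaining cases only |1 - A| matters. The formula Φ² = (2z² + b² - a² + 2y)/(a² + b²)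
(`IsLift.exp_sq`) gives |Φ(𝐨)| = 1. For Re ν ≠ 0 this makes |A_{ρ,n}| of order at most n^{|Re ν| -
1/2}, which settles |Re ν| < 1/2. If Re ν = 1/2, then A_{ρ,n+2j} is A_{ρ,n} times a unimodular
number tending to v^j, where v = Φ(𝟎)⁴ (`A_add`). When n and n + 2j both fail, this number is within
2ε of 1. But |v - 1| = 4ab/(a² + b²), which bounds the gaps (j = 1), and some power satisfies |v^j -
1| ≥ 1 > 2ε, which gives infinitude. -/

namespace CrossOP

/-! ### Real Jacobi elliptic functions. -/

/-- The incomplete elliptic integral `∫₀^φ dθ / √(a² + b² cos² θ)`. -/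
noncomputable def ellF (a b φ : ℝ) : ℝ := ∫ θ in (0 : ℝ)..φ, 1 / √(a ^ 2 + b ^ 2 * Real.cos θ ^ 2)

theorem radicand_pos {a : ℝ} (b : ℝ) (ha : 0 < a) (x : ℝ) : 0 < a ^ 2 + b ^ 2 * x ^ 2 := by
  positivity

theorem continuous_ellF_integrand {a : ℝ} (b : ℝ) (ha : 0 < a) :
    Continuous fun θ : ℝ => 1 / √(a ^ 2 + b ^ 2 * Real.cos θ ^ 2) := by
  refine continuous_const.div (by fun_prop) fun θ => ?_
  exact (Real.sqrt_pos.2 (radicand_pos b ha _)).ne'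

theorem hasDerivAt_ellF {a : ℝ} (b : ℝ) (ha : 0 < a) (φ : ℝ) :
    HasDerivAt (ellF a b) (1 / √(a ^ 2 + b ^ 2 * Real.cos φ ^ 2)) φ :=
  (continuous_ellF_integrand b ha).integral_hasStrictDerivAt 0 φ |>.hasDerivAt

theorem ellF_zero (a b : ℝ) : ellF a b 0 = 0 := by simp [ellF]

theorem continuous_ellF {a : ℝ} (b : ℝ) (ha : 0 < a) : Continuous (ellF a b) :=
  continuous_iff_continuousAt.2 fun φ => (hasDerivAt_ellF b ha φ).continuousAt

theorem strictMono_ellF {a : ℝ} (b : ℝ) (ha : 0 < a) : StrictMono (ellF a b) := by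
  refine strictMono_of_deriv_pos fun φ => ?_
  rw [(hasDerivAt_ellF b ha φ).deriv]
  have := Real.sqrt_pos.2 (radicand_pos b ha (Real.cos φ))
  positivity

/-- The integrand is at least 1/√(a² + b²), so `ellF` grows at least linearly in both directions.
This yields surjectivity and thus an amplitude on all of ℝ. -/
theorem monotone_ellF_sub {a : ℝ} (b : ℝ) (ha : 0 < a) :
    Monotone fun φ => ellF a b φ - φ / √(a ^ 2 + b ^ 2) := by
  have hd : ∀ φ, HasDerivAt (fun φ => ellF a b φ - φ / √(a ^ 2 + b ^ 2))
      (1 / √(a ^ 2 + b ^ 2 * Real.cos φ ^ 2) - 1 / √(a ^ 2 + b ^ 2)) φ := fun φ =>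
    (hasDerivAt_ellF b ha φ).sub ((hasDerivAt_id φ).div_const _)
  refine monotone_of_deriv_nonneg (fun φ => (hd φ).differentiableAt) fun φ => ?_
  rw [(hd φ).deriv, sub_nonneg]
  refine one_div_le_one_div_of_le (Real.sqrt_pos.2 (radicand_pos b ha _)) (Real.sqrt_le_sqrt ?_)
  nlinarith [Real.cos_sq_le_one φ, sq_nonneg b]

theorem surjective_ellF {a : ℝ} (b : ℝ) (ha : 0 < a) : Function.Surjective (ellF a b) := by
  have hl : 0 < √(a ^ 2 + b ^ 2) := by positivity
  have hm := monotone_ellF_sub b ha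
  refine (continuous_ellF b ha).surjective ?_ ?_
  · refine tendsto_atTop_mono' _ ?_ (tendsto_id.atTop_div_const hl)
    filter_upwards [eventually_ge_atTop 0] with φ hφ
    have := hm hφ
    simp only [ellF_zero, zero_div, sub_zero, id] at this ⊢
    linarith
  · refine tendsto_atBot_mono' _ ?_ (tendsto_id.atBot_div_const hl)
    filter_upwards [eventually_le_atBot 0] with φ hφ
    have := hm hφ
    simp only [ellF_zero, zero_div, sub_zero, id] at this ⊢
    linarith

/-- The integrand depends on cos² θ only, hence is symmetric about π/2. -/
theorem ellF_pi_sub {a : ℝ} (b : ℝ) (ha : 0 < a) (φ : ℝ) :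
    ellF a b (Real.pi - φ) + ellF a b φ = ellF a b Real.pi := by
  have hd : ∀ φ, HasDerivAt (fun φ => ellF a b (Real.pi - φ) + ellF a b φ) 0 φ := fun φ => by
    have h := ((hasDerivAt_ellF b ha (Real.pi - φ)).comp φ
      ((hasDerivAt_id φ).const_sub Real.pi)).add (hasDerivAt_ellF b ha φ)
    exact h.congr_deriv (by simp [Real.cos_pi_sub])
  have := is_const_of_deriv_eq_zero (fun x => (hd x).differentiableAt) (fun x => (hd x).deriv) φ 0
  simpa [ellF_zero] using this

/-- The complete elliptic integral. -/
noncomputable def quarter (a b : ℝ) : ℝ := ellF a b (Real.pi / 2)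

theorem quarter_pos {a : ℝ} (b : ℝ) (ha : 0 < a) : 0 < quarter a b := by
  have := strictMono_ellF b ha (show (0 : ℝ) < Real.pi / 2 by positivity)
  rwa [ellF_zero] at this

theorem ellF_pi {a : ℝ} (b : ℝ) (ha : 0 < a) : ellF a b Real.pi = 2 * quarter a b := by
  have := ellF_pi_sub b ha (Real.pi / 2)
  rw [← this, show Real.pi - Real.pi / 2 = Real.pi / 2 by ring, quarter]; ring

theorem ellF_add_pi {a : ℝ} (b : ℝ) (ha : 0 < a) (φ : ℝ) :
    ellF a b (φ + Real.pi) = ellF a b φ + 2 * quarter a b := by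
  have hd : ∀ φ, HasDerivAt (fun φ => ellF a b (φ + Real.pi) - ellF a b φ) 0 φ := fun φ => by
    have h := ((hasDerivAt_ellF b ha (φ + Real.pi)).comp φ
      ((hasDerivAt_id φ).add_const Real.pi)).sub (hasDerivAt_ellF b ha φ)
    exact h.congr_deriv (by simp [Real.cos_add_pi])
  have := is_const_of_deriv_eq_zero (fun x => (hd x).differentiableAt) (fun x => (hd x).deriv) φ 0
  simp only [ellF_zero, zero_add, sub_zero, ellF_pi b ha] at this
  linarith

theorem ellF_add_int_mul_pi {a : ℝ} (b : ℝ) (ha : 0 < a) (φ : ℝ) (m : ℤ) :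
    ellF a b (φ + m * Real.pi) = ellF a b φ + 2 * m * quarter a b := by
  induction m using Int.induction_on with
  | zero => simp
  | succ n ih =>
    have := ellF_add_pi b ha (φ + n * Real.pi)
    push_cast at ih ⊢
    rw [show φ + (n + 1) * Real.pi = φ + n * Real.pi + Real.pi by ring, this, ih]; ring
  | pred n ih =>
    have := ellF_add_pi b ha (φ + (-n - 1) * Real.pi)
    push_cast at ih ⊢
    rw [show φ + (-n - 1) * Real.pi + Real.pi = φ + -n * Real.pi by ring] at this
    linarith

/-- The amplitude, the inverse function of `ellF a b`. -/
noncomputable def am (a b : ℝ) : ℝ → ℝ := Function.invFun (ellF a b)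

theorem ellF_am {a : ℝ} (b : ℝ) (ha : 0 < a) (x : ℝ) : ellF a b (am a b x) = x :=
  Function.rightInverse_invFun (surjective_ellF b ha) x

theorem am_ellF {a : ℝ} (b : ℝ) (ha : 0 < a) (φ : ℝ) : am a b (ellF a b φ) = φ :=
  Function.leftInverse_invFun (strictMono_ellF b ha).injective φ

theorem continuous_am {a : ℝ} (b : ℝ) (ha : 0 < a) : Continuous (am a b) := by
  refine Monotone.continuous_of_surjective (fun x y h => ?_) fun φ => ⟨_, am_ellF b ha φ⟩
  rw [← (strictMono_ellF b ha).le_iff_le, ellF_am b ha, ellF_am b ha]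
  exact h

/-- The rescaled Jacobi function `sn`. -/
noncomputable def jS (a b x : ℝ) : ℝ := Real.sin (am a b x)

/-- The rescaled Jacobi function `cn`. -/
noncomputable def jC (a b x : ℝ) : ℝ := Real.cos (am a b x)

/-- The rescaled Jacobi function `√(a² + b²) dn`. -/
noncomputable def jD (a b x : ℝ) : ℝ := √(a ^ 2 + b ^ 2 * jC a b x ^ 2)

theorem jD_pos {a : ℝ} (b : ℝ) (ha : 0 < a) (x : ℝ) : 0 < jD a b x :=
  Real.sqrt_pos.2 (radicand_pos b ha _)

theorem jD_sq {a : ℝ} (b : ℝ) (ha : 0 < a) (x : ℝ) :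
    jD a b x ^ 2 = a ^ 2 + b ^ 2 * jC a b x ^ 2 :=
  Real.sq_sqrt (radicand_pos b ha _).le

theorem jS_sq (a b x : ℝ) : jS a b x ^ 2 = 1 - jC a b x ^ 2 := by
  have := Real.sin_sq_add_cos_sq (am a b x)
  unfold jS jC; linarith

theorem hasDerivAt_am {a : ℝ} (b : ℝ) (ha : 0 < a) (x : ℝ) :
    HasDerivAt (am a b) (jD a b x) x := by
  have h := HasDerivAt.of_local_left_inverse (continuous_am b ha).continuousAt
    (hasDerivAt_ellF b ha (am a b x))
    (one_div_ne_zero (Real.sqrt_pos.2 (radicand_pos b ha _)).ne')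
    (Eventually.of_forall (ellF_am b ha))
  simpa [jD, jC] using h

theorem hasDerivAt_jS {a : ℝ} (b : ℝ) (ha : 0 < a) (x : ℝ) :
    HasDerivAt (jS a b) (jC a b x * jD a b x) x :=
  (Real.hasDerivAt_sin _).comp x (hasDerivAt_am b ha x)

theorem hasDerivAt_jC {a : ℝ} (b : ℝ) (ha : 0 < a) (x : ℝ) :
    HasDerivAt (jC a b) (-jS a b x * jD a b x) x :=
  (Real.hasDerivAt_cos _).comp x (hasDerivAt_am b ha x)

theorem hasDerivAt_jD {a : ℝ} (b : ℝ) (ha : 0 < a) (x : ℝ) :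
    HasDerivAt (jD a b) (-b ^ 2 * jC a b x * jS a b x) x := by
  have h := ((((hasDerivAt_jC b ha x).pow 2).const_mul (b ^ 2)).const_add (a ^ 2)).sqrt
    (radicand_pos b ha _).ne'
  refine HasDerivAt.congr_deriv h ?_
  have h1 := jD_pos b ha x
  have h2 : √(a ^ 2 + b ^ 2 * (jC a b ^ 2) x) = jD a b x := rfl
  rw [h2]
  field_simp
  simp only [Nat.cast_ofNat, Nat.add_one_sub_one, pow_one, neg_inj]
  ring

/-- The sign of the companion function is recorded with each zero because it later decides the sheet
of a pole. -/
theorem jC_eq_zero {a : ℝ} (b : ℝ) (ha : 0 < a) {x : ℝ} (h : jC a b x = 0) :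
    ∃ m : ℤ, x = (2 * m + 1) * quarter a b ∧ jS a b x = (-1) ^ m := by
  obtain ⟨m, hm⟩ := Real.cos_eq_zero_iff.1 h
  refine ⟨m, ?_, ?_⟩
  · rw [← ellF_am b ha x, hm, show (2 * (m : ℝ) + 1) * Real.pi / 2 = Real.pi / 2 + m * Real.pi by
      ring, ellF_add_int_mul_pi b ha, ← quarter]; ring
  · rw [jS, hm, show (2 * (m : ℝ) + 1) * Real.pi / 2 = Real.pi / 2 + m * Real.pi by ring,
      Real.sin_add_int_mul_pi, Real.sin_pi_div_two, mul_one]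

theorem jS_eq_zero {a : ℝ} (b : ℝ) (ha : 0 < a) {x : ℝ} (h : jS a b x = 0) :
    ∃ n : ℤ, x = 2 * n * quarter a b ∧ jC a b x = (-1) ^ n := by
  obtain ⟨n, hn⟩ := Real.sin_eq_zero_iff.1 h
  refine ⟨n, ?_, ?_⟩
  · have := ellF_add_int_mul_pi b ha 0 n
    rw [zero_add, hn, ellF_am b ha, ellF_zero, zero_add] at this
    exact this
  · rw [jC, ← hn, Real.cos_int_mul_pi]

theorem jC_odd_mul_quarter {a : ℝ} (b : ℝ) (ha : 0 < a) (m : ℤ) :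
    jC a b ((2 * m + 1) * quarter a b) = 0 := by
  have := ellF_add_int_mul_pi b ha (Real.pi / 2) m
  rw [← quarter] at this
  rw [jC, show (2 * (m : ℝ) + 1) * quarter a b = quarter a b + 2 * m * quarter a b by ring, ← this,
    am_ellF b ha, Real.cos_add_int_mul_pi, Real.cos_pi_div_two, mul_zero]

theorem jS_even_mul_quarter {a : ℝ} (b : ℝ) (ha : 0 < a) (n : ℤ) :
    jS a b (2 * n * quarter a b) = 0 := by
  have := ellF_add_int_mul_pi b ha 0 n
  rw [ellF_zero, zero_add, zero_add] at this
  rw [jS, ← this, am_ellF b ha, Real.sin_int_mul_pi]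


/-! ### Complex derivatives from real partial derivatives. -/

/-- `f` is real differentiable at `u`, with the partial derivatives `p` and `q`. -/
def HasPartials (f : ℂ → ℂ) (p q u : ℂ) : Prop :=
  HasFDerivAt f (reCLM.smulRight p + imCLM.smulRight q : ℂ →L[ℝ] ℂ) u

namespace HasPartials

variable {f g : ℂ → ℂ} {p q p' q' u : ℂ}

theorem congr (h : HasPartials f p q u) (hp : p = p') (hq : q = q') : HasPartials f p' q' u :=
  hp ▸ hq ▸ h

theorem add (hf : HasPartials f p q u) (hg : HasPartials g p' q' u) :
    HasPartials (fun u => f u + g u) (p + p') (q + q') u := by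
  refine (HasFDerivAt.add hf hg).congr_fderiv (ContinuousLinearMap.ext fun v => ?_)
  simp only [add_apply, ContinuousLinearMap.smulRight_apply, smul_add]
  ring

theorem mul (hf : HasPartials f p q u) (hg : HasPartials g p' q' u) :
    HasPartials (fun u => f u * g u) (p * g u + f u * p') (q * g u + f u * q') u := by
  refine (HasFDerivAt.mul hf hg).congr_fderiv (ContinuousLinearMap.ext fun v => ?_)
  simp only [add_apply, ContinuousLinearMap.smulRight_apply,
    smul_apply, real_smul, smul_eq_mul]
  ring

theorem const (k : ℂ) : HasPartials (fun _ => k) 0 0 u := by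
  refine (hasFDerivAt_const k u).congr_fderiv (ContinuousLinearMap.ext fun v => ?_)
  simp

/-- The form of the second partial derivative is the Cauchy–Riemann equation. -/
theorem hasDerivAt (hf : HasPartials f p (I * p) u) : HasDerivAt f p u := by
  refine hasDerivAt_iff_hasFDerivAt.2
    (hasFDerivAt_of_restrictScalars ℝ hf (ContinuousLinearMap.ext fun v => ?_))
  simp only [ContinuousLinearMap.coe_restrictScalars', ContinuousLinearMap.toSpanSingleton_apply,
    add_apply, ContinuousLinearMap.smulRight_apply, reCLM_apply, imCLM_apply, real_smul, smul_eq_mul]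
  nth_rw 1 [← re_add_im v]
  ring

theorem inv (hf : HasPartials f p q u) (h0 : f u ≠ 0) :
    HasPartials (fun u => (f u)⁻¹) (-p / f u ^ 2) (-q / f u ^ 2) u := by
  refine (((hasDerivAt_inv h0).hasFDerivAt.restrictScalars ℝ).comp u hf).congr_fderiv
    (ContinuousLinearMap.ext fun v => ?_)
  simp
  ring

theorem ofReal_re {r : ℝ → ℝ} {r' : ℝ} (h : HasDerivAt r r' u.re) :
    HasPartials (fun u => (r u.re : ℂ)) r' 0 u := by
  refine (h.ofReal_comp.hasFDerivAt.comp u reCLM.hasFDerivAt).congr_fderiv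
    (ContinuousLinearMap.ext fun v => ?_)
  simp

theorem ofReal_im {r : ℝ → ℝ} {r' : ℝ} (h : HasDerivAt r r' u.im) :
    HasPartials (fun u => (r u.im : ℂ)) 0 r' u := by
  refine (h.ofReal_comp.hasFDerivAt.comp u imCLM.hasFDerivAt).congr_fderiv
    (ContinuousLinearMap.ext fun v => ?_)
  simp

end HasPartials

/-! ### Elliptic functions parametrizing the curve. -/

/-- The denominator of the elliptic functions `elZ`, `elG`, `elH`. -/
noncomputable def elE (a b : ℝ) (u : ℂ) : ℝ :=
  jC a b u.re ^ 2 * jD b a u.im ^ 2 + a ^ 2 * jS b a u.im ^ 2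

/-- The elliptic function `Z` with `Z'² = (Z² - a²)(Z² + b²)` and `Z 0 = -a`, that is, `-a / cn`. -/
noncomputable def elZ (a b : ℝ) (u : ℂ) : ℂ :=
  -a * ((a ^ 2 + b ^ 2) * jC a b u.re * jC b a u.im +
    I * jS a b u.re * jD a b u.re * jS b a u.im * jD b a u.im) / elE a b u

/-- The elliptic function with `(a² + b²) elG² = elZ² - a²`. -/
noncomputable def elG (a b : ℝ) (u : ℂ) : ℂ :=
  a * (jS a b u.re * jC a b u.re * jC b a u.im * jD b a u.im + I * jD a b u.re * jS b a u.im) /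
    elE a b u

/-- The elliptic function with `(a² + b²) elH² = elZ² + b²`. -/
noncomputable def elH (a b : ℝ) (u : ℂ) : ℂ :=
  (jC a b u.re * jD a b u.re * jD b a u.im +
    I * a ^ 2 * jS a b u.re * jS b a u.im * jC b a u.im) / elE a b u

/-- The derivative of `elZ`. -/
noncomputable def elY (a b : ℝ) (u : ℂ) : ℂ := -(a ^ 2 + b ^ 2) * elG a b u * elH a b u

section

variable {a b : ℝ} (ha : 0 < a) (hb : 0 < b) (u : ℂ)

theorem ofReal_elE : (elE a b u : ℂ) =
    jC a b u.re ^ 2 * jD b a u.im ^ 2 + a ^ 2 * jS b a u.im ^ 2 := by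
  simp [elE]

include ha hb in
-- For u = x + iy, the addition theorem and Jacobi's imaginary transformation express cn u through
-- real functions of x for (a, b) and of y for (b, a), the complementary modulus. These relations
-- and i² = -1 are what the polynomial identities for `elZ`, `elG`, `elH` rest on.
theorem jacobi_relations :
    (jS a b u.re : ℂ) ^ 2 = 1 - (jC a b u.re : ℂ) ^ 2 ∧
    (jD a b u.re : ℂ) ^ 2 = a ^ 2 + b ^ 2 * (jC a b u.re : ℂ) ^ 2 ∧
    (jS b a u.im : ℂ) ^ 2 = 1 - (jC b a u.im : ℂ) ^ 2 ∧
    (jD b a u.im : ℂ) ^ 2 = b ^ 2 + a ^ 2 * (jC b a u.im : ℂ) ^ 2 := by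
  refine ⟨?_, ?_, ?_, ?_⟩
  · exact_mod_cast jS_sq a b u.re
  · exact_mod_cast jD_sq b ha u.re
  · exact_mod_cast jS_sq b a u.im
  · exact_mod_cast jD_sq a hb u.im

end

section

variable {a b : ℝ} (ha : 0 < a) (hb : 0 < b) {u : ℂ} (hu : elE a b u ≠ 0)

include ha in
theorem hasPartials_re :
    HasPartials (fun u => (jC a b u.re : ℂ)) (-jS a b u.re * jD a b u.re) 0 u ∧
    HasPartials (fun u => (jS a b u.re : ℂ)) (jC a b u.re * jD a b u.re) 0 u ∧
    HasPartials (fun u => (jD a b u.re : ℂ)) (-b ^ 2 * jC a b u.re * jS a b u.re) 0 u := by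
  refine ⟨?_, ?_, ?_⟩
  · simpa using HasPartials.ofReal_re (hasDerivAt_jC b ha u.re)
  · simpa using HasPartials.ofReal_re (hasDerivAt_jS b ha u.re)
  · simpa using HasPartials.ofReal_re (hasDerivAt_jD b ha u.re)

include hb in
theorem hasPartials_im :
    HasPartials (fun u => (jC b a u.im : ℂ)) 0 (-jS b a u.im * jD b a u.im) u ∧
    HasPartials (fun u => (jS b a u.im : ℂ)) 0 (jC b a u.im * jD b a u.im) u ∧
    HasPartials (fun u => (jD b a u.im : ℂ)) 0 (-a ^ 2 * jC b a u.im * jS b a u.im) u := by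
  refine ⟨?_, ?_, ?_⟩
  · simpa using HasPartials.ofReal_im (hasDerivAt_jC a hb u.im)
  · simpa using HasPartials.ofReal_im (hasDerivAt_jS a hb u.im)
  · simpa using HasPartials.ofReal_im (hasDerivAt_jD a hb u.im)

include ha hb

theorem hasPartials_elE :
    HasPartials (fun u => (elE a b u : ℂ))
      (-2 * jC a b u.re * jS a b u.re * jD a b u.re * jD b a u.im ^ 2)
      (2 * a ^ 2 * jS b a u.im * jC b a u.im * jD b a u.im * jS a b u.re ^ 2) u := by
  obtain ⟨hC, hS, hD⟩ := hasPartials_re ha (u := u)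
  obtain ⟨hC1, hS1, hD1⟩ := hasPartials_im hb (u := u)
  obtain ⟨r1, r2, r3, r4⟩ := jacobi_relations ha hb u
  have h := ((hC.mul hC).mul (hD1.mul hD1)).add ((HasPartials.const ((a : ℂ) ^ 2)).mul (hS1.mul hS1))
  have hf : (fun u => (elE a b u : ℂ)) = fun u : ℂ =>
      (jC a b u.re : ℂ) * jC a b u.re * (jD b a u.im * jD b a u.im) +
        (a : ℂ) ^ 2 * (jS b a u.im * jS b a u.im) := by
    funext u; rw [ofReal_elE]; ring
  rw [hf]
  refine h.congr ?_ ?_ <;> grind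

include hu

/-- This is the quotient rule with E² cleared: `hp` and `hq` say that the partial derivatives of f/E
are d and id, and become polynomial identities in the Jacobi functions. -/
theorem HasPartials.div_elE {f : ℂ → ℂ} {p q d : ℂ} (hf : HasPartials f p q u)
    (hp : p * elE a b u + f u * (2 * jC a b u.re * jS a b u.re * jD a b u.re * jD b a u.im ^ 2) =
      d * elE a b u ^ 2)
    (hq : q * elE a b u -
      f u * (2 * a ^ 2 * jS b a u.im * jC b a u.im * jD b a u.im * jS a b u.re ^ 2) =
      I * (d * elE a b u ^ 2)) :
    HasDerivAt (fun u => f u / elE a b u) d u := by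
  have hE : (elE a b u : ℂ) ≠ 0 := ofReal_ne_zero.2 hu
  have h := hf.mul ((hasPartials_elE ha hb (u := u)).inv hE)
  simp only [← div_eq_mul_inv] at h
  refine (h.congr (p' := d) (q' := I * d) ?_ ?_).hasDerivAt
  · field_simp
    linear_combination hp
  · field_simp
    linear_combination hq

omit ha hb in
theorem elG_mul_elE : elG a b u * elE a b u =
    a * (jS a b u.re * jC a b u.re * jC b a u.im * jD b a u.im + I * jD a b u.re * jS b a u.im) :=
  div_mul_cancel₀ _ (ofReal_ne_zero.2 hu)

omit ha hb in
theorem elH_mul_elE : elH a b u * elE a b u =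
    jC a b u.re * jD a b u.re * jD b a u.im + I * a ^ 2 * jS a b u.re * jS b a u.im * jC b a u.im :=
  div_mul_cancel₀ _ (ofReal_ne_zero.2 hu)

omit ha hb in
theorem elZ_mul_elE : elZ a b u * elE a b u =
    -a * ((a ^ 2 + b ^ 2) * jC a b u.re * jC b a u.im +
      I * jS a b u.re * jD a b u.re * jS b a u.im * jD b a u.im) :=
  div_mul_cancel₀ _ (ofReal_ne_zero.2 hu)

theorem hasDerivAt_elZ : HasDerivAt (elZ a b) (elY a b u) u := by
  obtain ⟨hC, hS, hD⟩ := hasPartials_re ha (u := u)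
  obtain ⟨hC1, hS1, hD1⟩ := hasPartials_im hb (u := u)
  obtain ⟨r1, r2, r3, r4⟩ := jacobi_relations ha hb u
  have hI := I_sq
  have hY : elY a b u * elE a b u ^ 2 =
      -(a ^ 2 + b ^ 2) * (elG a b u * elE a b u) * (elH a b u * elE a b u) := by
    unfold elY; ring
  refine HasPartials.div_elE ha hb hu ((HasPartials.const (-(a : ℂ))).mul
    ((((HasPartials.const ((a : ℂ) ^ 2 + b ^ 2)).mul hC).mul hC1).add
      (((((HasPartials.const I).mul hS).mul hD).mul hS1).mul hD1))) ?_ ?_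
  all_goals
    clear hC hS hD hC1 hS1 hD1
    rw [hY, elG_mul_elE hu, elH_mul_elE hu, ofReal_elE]
    grind

theorem hasDerivAt_elG : HasDerivAt (elG a b) (-elZ a b u * elH a b u) u := by
  obtain ⟨hC, hS, hD⟩ := hasPartials_re ha (u := u)
  obtain ⟨hC1, hS1, hD1⟩ := hasPartials_im hb (u := u)
  obtain ⟨r1, r2, r3, r4⟩ := jacobi_relations ha hb u
  have hI := I_sq
  have hY : -elZ a b u * elH a b u * elE a b u ^ 2 =
      -(elZ a b u * elE a b u) * (elH a b u * elE a b u) := by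
    ring
  refine HasPartials.div_elE ha hb hu ((HasPartials.const (a : ℂ)).mul
    ((((hS.mul hC).mul hC1).mul hD1).add (((HasPartials.const I).mul hD).mul hS1))) ?_ ?_
  all_goals
    clear hC hS hD hC1 hS1 hD1
    rw [hY, elZ_mul_elE hu, elH_mul_elE hu, ofReal_elE]
    grind

theorem hasDerivAt_elH : HasDerivAt (elH a b) (-elZ a b u * elG a b u) u := by
  obtain ⟨hC, hS, hD⟩ := hasPartials_re ha (u := u)
  obtain ⟨hC1, hS1, hD1⟩ := hasPartials_im hb (u := u)
  obtain ⟨r1, r2, r3, r4⟩ := jacobi_relations ha hb u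
  have hI := I_sq
  have hY : -elZ a b u * elG a b u * elE a b u ^ 2 =
      -(elZ a b u * elE a b u) * (elG a b u * elE a b u) := by
    ring
  refine HasPartials.div_elE ha hb hu (((hC.mul hD).mul hD1).add
    (((((HasPartials.const I).mul (HasPartials.const ((a : ℂ) ^ 2))).mul hS).mul hS1).mul hC1)) ?_ ?_
  all_goals
    clear hC hS hD hC1 hS1 hD1
    rw [hY, elZ_mul_elE hu, elG_mul_elE hu, ofReal_elE]
    grind

theorem elG_sq : (a ^ 2 + b ^ 2) * elG a b u ^ 2 = elZ a b u ^ 2 - a ^ 2 := by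
  obtain ⟨r1, r2, r3, r4⟩ := jacobi_relations ha hb u
  have hI := I_sq
  have hE : (elE a b u : ℂ) ≠ 0 := ofReal_ne_zero.2 hu
  refine mul_right_cancel₀ (pow_ne_zero 2 hE) ?_
  have h : (a ^ 2 + b ^ 2) * (elG a b u * elE a b u) ^ 2 =
      (elZ a b u * elE a b u) ^ 2 - (a * elE a b u) ^ 2 := by
    rw [elZ_mul_elE hu, elG_mul_elE hu, ofReal_elE]
    grind
  linear_combination h

theorem elH_sq : (a ^ 2 + b ^ 2) * elH a b u ^ 2 = elZ a b u ^ 2 + b ^ 2 := by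
  obtain ⟨r1, r2, r3, r4⟩ := jacobi_relations ha hb u
  have hI := I_sq
  have hE : (elE a b u : ℂ) ≠ 0 := ofReal_ne_zero.2 hu
  refine mul_right_cancel₀ (pow_ne_zero 2 hE) ?_
  have h : (a ^ 2 + b ^ 2) * (elH a b u * elE a b u) ^ 2 =
      (elZ a b u * elE a b u) ^ 2 + (b * elE a b u) ^ 2 := by
    rw [elZ_mul_elE hu, elH_mul_elE hu, ofReal_elE]
    grind
  linear_combination h

theorem elY_sq : elY a b u ^ 2 = (elZ a b u ^ 2 - a ^ 2) * (elZ a b u ^ 2 + b ^ 2) := by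
  rw [← elG_sq ha hb hu, ← elH_sq ha hb hu, elY]
  ring

theorem hasDerivAt_elY :
    HasDerivAt (elY a b) (elZ a b u * (2 * elZ a b u ^ 2 + b ^ 2 - a ^ 2)) u := by
  refine (((hasDerivAt_elG ha hb hu).const_mul (-((a : ℂ) ^ 2 + b ^ 2))).mul
    (hasDerivAt_elH ha hb hu)).congr_deriv ?_
  linear_combination elZ a b u * elG_sq ha hb hu + elZ a b u * elH_sq ha hb hu

end

/-- The denominator of `1 / elZ`. -/
noncomputable def elM (a b : ℝ) (u : ℂ) : ℝ :=
  (a ^ 2 + b ^ 2) * jC b a u.im ^ 2 + b ^ 2 * jS a b u.re ^ 2 * jS b a u.im ^ 2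

section

variable {a b : ℝ} (ha : 0 < a) (hb : 0 < b) {u : ℂ}

include ha hb

theorem continuous_elE : Continuous (elE a b) := by
  have h1 : Continuous (jC b a) := Real.continuous_cos.comp (continuous_am a hb)
  have h2 : Continuous (jC a b) := Real.continuous_cos.comp (continuous_am b ha)
  have h3 : Continuous (jS b a) := Real.continuous_sin.comp (continuous_am a hb)
  unfold elE jD
  fun_prop

theorem continuous_elM : Continuous (elM a b) := by
  have h1 : Continuous (jC b a) := Real.continuous_cos.comp (continuous_am a hb)
  have h2 : Continuous (jS a b) := Real.continuous_sin.comp (continuous_am b ha)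
  have h3 : Continuous (jS b a) := Real.continuous_sin.comp (continuous_am a hb)
  unfold elM
  fun_prop

/-- Being free of denominators, this identity survives passage to a limit. As `elM` is positive
wherever `elE` vanishes, it separates finite points from poles. -/
theorem normSq_elZ_mul_elE (hu : elE a b u ≠ 0) :
    normSq (elZ a b u) * elE a b u = a ^ 2 * elM a b u := by
  refine mul_right_cancel₀ hu ?_
  have h : normSq (elZ a b u * elE a b u) = a ^ 2 * elM a b u * elE a b u := by
    rw [elZ_mul_elE hu, normSq_apply]
    have r1 := jS_sq a b u.re
    have r2 := jD_sq b ha u.re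
    have r3 := jS_sq b a u.im
    have r4 := jD_sq a hb u.im
    simp [elM, elE, ← ofReal_pow]
    grind
  rw [map_mul, normSq_ofReal] at h
  linear_combination h

theorem elE_eq_zero (hu : elE a b u = 0) : jC a b u.re = 0 ∧ jS b a u.im = 0 := by
  have h1 := jD_pos a hb u.im
  unfold elE at hu
  rw [add_eq_zero_iff_of_nonneg (by positivity) (by positivity)] at hu
  simpa [h1.ne', ha.ne'] using hu

theorem elM_of_elE_eq_zero (hu : elE a b u = 0) : elM a b u = a ^ 2 + b ^ 2 := by
  obtain ⟨h1, h2⟩ := elE_eq_zero ha hb hu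
  have := jS_sq b a u.im
  rw [h2] at this
  rw [elM, h2]
  linear_combination (a ^ 2 + b ^ 2) * this

/-- Y/Z² gets the denominator `elM` in place of `elE`, so that its limit at a pole can be read off.
-/
theorem elY_mul_sq (hu : elE a b u ≠ 0) :
    elY a b u * a * elM a b u ^ 2 = -(a ^ 2 + b ^ 2) * elZ a b u ^ 2 *
      ((jS a b u.re * jD b a u.im + I * jC a b u.re * jD a b u.re * jS b a u.im * jC b a u.im) *
        (jD a b u.re * jC b a u.im * jD b a u.im -
          I * b ^ 2 * jS a b u.re * jC a b u.re * jS b a u.im)) := by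
  obtain ⟨r1, r2, r3, r4⟩ := jacobi_relations ha hb u
  have hI := I_sq
  have hE : (elE a b u : ℂ) ≠ 0 := ofReal_ne_zero.2 hu
  have hM : (elM a b u : ℂ) = (a ^ 2 + b ^ 2) * jC b a u.im ^ 2 +
      b ^ 2 * jS a b u.re ^ 2 * jS b a u.im ^ 2 := by simp [elM]
  -- With R1, R2 the two brackets of the statement, GM = -Z·R1 and aHM = -Z·R2; the claim is their
  -- product, since Y = -(a² + b²)GH.
  have h1 : (elG a b u * elE a b u) * elM a b u = -elZ a b u * elE a b u *
      (jS a b u.re * jD b a u.im +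
        I * jC a b u.re * jD a b u.re * jS b a u.im * jC b a u.im) := by
    rw [neg_mul, elZ_mul_elE hu, elG_mul_elE hu, hM]
    grind
  have h2 : a * (elH a b u * elE a b u) * elM a b u = -elZ a b u * elE a b u *
      (jD a b u.re * jC b a u.im * jD b a u.im -
          I * b ^ 2 * jS a b u.re * jC a b u.re * jS b a u.im) := by
    clear h1
    rw [neg_mul, elZ_mul_elE hu, elH_mul_elE hu, hM]
    grind
  refine mul_right_cancel₀ (pow_ne_zero 2 hE) ?_
  generalize jS a b u.re * jD b a u.im +
    I * jC a b u.re * jD a b u.re * jS b a u.im * jC b a u.im = R1 at *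
  generalize jD a b u.re * jC b a u.im * jD b a u.im -
    I * b ^ 2 * jS a b u.re * jC a b u.re * jS b a u.im = R2 at *
  unfold elY
  linear_combination -((a : ℂ) ^ 2 + b ^ 2) * (a * (elH a b u * elE a b u) * elM a b u) * h1 +
    (a ^ 2 + b ^ 2) * elZ a b u * elE a b u * R1 * h2

/-- The real part of `elY / elZ²` determines the sheet. -/
theorem re_elY_div_sq (hu : elE a b u ≠ 0) (hm : elM a b u ≠ 0) :
    (elY a b u / elZ a b u ^ 2).re * (a * elM a b u ^ 2) =
      -((a ^ 2 + b ^ 2) * (jS a b u.re * jC b a u.im * jD a b u.re *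
        (jD b a u.im ^ 2 + b ^ 2 * jC a b u.re ^ 2 * jS b a u.im ^ 2))) := by
  have hZ : elZ a b u ≠ 0 := by
    intro h0
    have := normSq_elZ_mul_elE ha hb hu
    rw [h0, map_zero, zero_mul, eq_comm] at this
    simp [ha.ne', hm] at this
  have h : elY a b u / elZ a b u ^ 2 * (a * elM a b u ^ 2 : ℝ) = -(a ^ 2 + b ^ 2 : ℝ) *
      ((jS a b u.re * jD b a u.im + I * jC a b u.re * jD a b u.re * jS b a u.im * jC b a u.im) *
        (jD a b u.re * jC b a u.im * jD b a u.im -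
          I * b ^ 2 * jS a b u.re * jC a b u.re * jS b a u.im)) := by
    rw [div_mul_eq_mul_div, div_eq_iff (pow_ne_zero 2 hZ)]
    push_cast
    linear_combination elY_mul_sq ha hb hu
  have h' := congrArg re h
  rw [re_mul_ofReal] at h'
  rw [h', ← ofReal_neg, re_ofReal_mul]
  simp [← ofReal_pow]
  ring

end


/-! ### Uniformization of paths on the curve. -/

/-- A square root, continuous along a curve, of a differentiable function is differentiable. -/
theorem hasDerivAt_of_sq {y p : ℝ → ℂ} {t : ℝ} {p' : ℂ} (hp : HasDerivAt p p' t)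
    (hy : ContinuousAt y t) (hsq : ∀ᶠ s in 𝓝 t, y s ^ 2 = p s) (h0 : y t ≠ 0) :
    HasDerivAt y (p' / (2 * y t)) t := by
  -- Near y(t) ≠ 0 squaring has a differentiable inverse, and continuity forces y to be that inverse
  -- applied to p.
  have hd : HasStrictDerivAt (fun x : ℂ => x ^ 2) (2 * y t) (y t) := by
    simpa using hasStrictDerivAt_pow 2 (y t)
  have h2 : (2 * y t) ≠ 0 := mul_ne_zero two_ne_zero h0
  have hl := hd.eventually_left_inverse h2
  have hi := (hd.to_localInverse h2).hasDerivAt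
  rw [hsq.self_of_nhds] at hi
  have hc := HasDerivAt.scomp t (h := p) hi hp
  refine (hc.congr_of_eventuallyEq ?_).congr_deriv ?_
  · filter_upwards [hy.eventually hl, hsq] with s hs hs'
    rw [Function.comp_apply, ← hs', hs]
  · rw [smul_eq_mul, ← div_eq_mul_inv]

/-- The inverse function theorem with the derivative of the inverse at all nearby points. -/
theorem exists_local_inverse {ch s : ℂ → ℂ} {u₀ : ℂ}
    (hder : ∀ᶠ u in 𝓝 u₀, HasDerivAt ch (s u) u) (hs : ContinuousAt s u₀) (h0 : s u₀ ≠ 0) :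
    ∃ f : ℂ → ℂ, f (ch u₀) = u₀ ∧ ContinuousAt f (ch u₀) ∧
      ∀ᶠ x in 𝓝 (ch u₀), ch (f x) = x ∧ s (f x) ≠ 0 ∧ HasDerivAt f (s (f x))⁻¹ x := by
  have hch : HasStrictDerivAt ch (s u₀) u₀ := hasStrictDerivAt_of_hasDerivAt_of_continuousAt hder hs
  have hch' := hch.hasStrictFDerivAt_equiv h0
  set e := hch'.toOpenPartialHomeomorph ch
  have hu : u₀ ∈ e.source := hch'.mem_toOpenPartialHomeomorph_source
  have ht : ch u₀ ∈ e.target := hch'.image_mem_toOpenPartialHomeomorph_target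
  have hf0 : e.symm (ch u₀) = u₀ := e.left_inv hu
  have hfc : ContinuousAt e.symm (ch u₀) := e.continuousAt_symm ht
  have hr : ∀ᶠ x in 𝓝 (ch u₀), ch (e.symm x) = x := e.eventually_right_inverse ht
  have hd : ∀ᶠ x in 𝓝 (ch u₀), HasDerivAt ch (s (e.symm x)) (e.symm x) ∧ s (e.symm x) ≠ 0 := by
    have hN := hder.and (hs.eventually_ne h0)
    rw [← hf0] at hN
    exact hfc.eventually hN
  refine ⟨e.symm, hf0, hfc, ?_⟩
  filter_upwards [hd, hr.eventually_nhds, e.open_target.mem_nhds ht] with x h1 h2 h3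
  exact ⟨h2.self_of_nhds, h1.2,
    HasDerivAt.of_local_left_inverse (e.continuousAt_symm h3) h1.1 h1.2 h2⟩

/-- A function with zero derivative on an interval equals its limit at the left endpoint. -/
theorem eq_of_hasDerivAt_zero {f : ℝ → ℂ} {α β : ℝ} {L : ℂ} (hf : Tendsto f (𝓝[>] α) (𝓝 L))
    (hd : ∀ t ∈ Ioo α β, HasDerivAt f 0 t) {t : ℝ} (ht : t ∈ Ioo α β) : f t = L := by
  have heq : ∀ t' ∈ Ioo α β, f t' = f t := fun t' ht' =>
    isOpen_Ioo.is_const_of_deriv_eq_zero isPreconnected_Ioo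
      (fun x hx => (hd x hx).differentiableAt.differentiableWithinAt)
      (fun x hx => (hd x hx).deriv) ht' ht
  refine tendsto_nhds_unique (tendsto_const_nhds.congr' ?_) hf
  filter_upwards [Ioo_mem_nhdsGT (ht.1.trans ht.2)] with t' ht' using (heq t' ht').symm

/-- If `f` is the inverse of a local coordinate `ch`, and `f ∘ κ` and `U` have the same derivative
to the right of `t₀` and the same value at `t₀`, then they coincide to the right of `t₀`. -/
theorem eventually_eq_of_chart {f s : ℂ → ℂ} {κ κ' U U' : ℝ → ℂ} {t₀ : ℝ}
    (hf0 : f (κ t₀) = U t₀) (hfc : ContinuousAt f (κ t₀))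
    (hf : ∀ᶠ x in 𝓝 (κ t₀), s (f x) ≠ 0 ∧ HasDerivAt f (s (f x))⁻¹ x)
    (hκt : Tendsto κ (𝓝[>] t₀) (𝓝 (κ t₀))) (hUt : Tendsto U (𝓝[>] t₀) (𝓝 (U t₀)))
    (hκ : ∀ᶠ t in 𝓝[>] t₀, HasDerivAt κ (κ' t) t) (hU : ∀ᶠ t in 𝓝[>] t₀, HasDerivAt U (U' t) t)
    (hrel : ∀ᶠ t in 𝓝[>] t₀, κ' t = s (f (κ t)) * U' t) :
    ∀ᶠ t in 𝓝[>] t₀, f (κ t) = U t := by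
  have hall := hκ.and (hU.and (hrel.and (hκt.eventually hf)))
  obtain ⟨δ, hδ, hI⟩ := (mem_nhdsGT_iff_exists_Ioo_subset).1 hall
  have hd : ∀ t ∈ Ioo t₀ δ, HasDerivAt (fun t => f (κ t) - U t) 0 t := fun t ht => by
    obtain ⟨h1, h2, h3, h5, h4⟩ := hI ht
    refine ((HasDerivAt.scomp t h4 h1).sub h2).congr_deriv ?_
    rw [smul_eq_mul, h3]
    field_simp
    simp
  have hc0 : Tendsto (fun t => f (κ t) - U t) (𝓝[>] t₀) (𝓝 0) := by
    have := (hfc.tendsto.comp hκt).sub hUt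
    simpa [hf0] using this
  filter_upwards [Ioo_mem_nhdsGT hδ] with t ht
  exact sub_eq_zero.1 (eq_of_hasDerivAt_zero hc0 hd ht)

/-- A path `(z, y)` on the curve `y² = (z² - a²)(z² + b²)`, parametrized by `[0, 1)`, together with
the integral `U` of `dz / y` along it. -/
structure IsCurvePath (a b : ℝ) (z y U : ℝ → ℂ) : Prop where
  cont_z : ContinuousOn z (Ico 0 1)
  cont_y : ContinuousOn y (Ico 0 1)
  cont_U : ContinuousOn U (Ico 0 1)
  sq_eq : ∀ t ∈ Ioo (0 : ℝ) 1, y t ^ 2 = (z t ^ 2 - (a : ℂ) ^ 2) * (z t ^ 2 + (b : ℂ) ^ 2)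
  ne_zero : ∀ t ∈ Ioo (0 : ℝ) 1, y t ≠ 0
  diff : ∀ t ∈ Ioo (0 : ℝ) 1, DifferentiableAt ℝ z t
  deriv_U : ∀ t ∈ Ioo (0 : ℝ) 1, HasDerivAt U (deriv z t / y t) t

namespace IsCurvePath

variable {a b : ℝ} {z y U : ℝ → ℂ} (h : IsCurvePath a b z y U)

include h

/-- Differentiating the equation gives 2yy'. Written as a multiple of z'/y, the result matches the
derivative of `elY`, so that y can serve as a coordinate. -/
theorem hasDerivAt_y {t : ℝ} (ht : t ∈ Ioo (0 : ℝ) 1) :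
    HasDerivAt y (z t * (2 * z t ^ 2 + b ^ 2 - a ^ 2) * (deriv z t / y t)) t := by
  have hz := (h.diff t ht).hasDerivAt
  have hp := ((hz.fun_pow 2).sub_const ((a : ℂ) ^ 2)).mul ((hz.fun_pow 2).add_const ((b : ℂ) ^ 2))
  have := hasDerivAt_of_sq hp (h.cont_y.continuousAt (Ico_mem_nhds ht.1 ht.2)) (t := t)
    (by filter_upwards [Ioo_mem_nhds ht.1 ht.2] with s hs using h.sq_eq s hs) (h.ne_zero t ht)
  refine this.congr_deriv ?_
  have := h.ne_zero t ht
  field_simp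
  push_cast
  ring

theorem tendsto_right {t : ℝ} (ht : t ∈ Ico (0 : ℝ) 1) : Tendsto z (𝓝[>] t) (𝓝 (z t)) ∧
    Tendsto y (𝓝[>] t) (𝓝 (y t)) ∧ Tendsto U (𝓝[>] t) (𝓝 (U t)) := by
  have hle : 𝓝[>] t ≤ 𝓝[Ico 0 1] t := by
    rw [← nhdsWithin_Ioo_eq_nhdsGT ht.2]
    exact nhdsWithin_mono _ fun s hs => ⟨ht.1.trans hs.1.le, hs.2⟩
  exact ⟨(h.cont_z t ht).mono_left hle, (h.cont_y t ht).mono_left hle,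
    (h.cont_U t ht).mono_left hle⟩

omit h in
theorem eventually_Ioo {t : ℝ} (ht : t ∈ Ico (0 : ℝ) 1) : ∀ᶠ s in 𝓝[>] t, s ∈ Ioo (0 : ℝ) 1 := by
  filter_upwards [Ioo_mem_nhdsGT ht.2] with s hs using ⟨ht.1.trans_lt hs.1, hs.2⟩

variable (ha : 0 < a) (hb : 0 < b)

include ha hb

/-- Where y ≠ 0, z is a local coordinate: a local inverse f of `elZ`, applied to z, has the
derivative z'/y of U and therefore equals U. -/
theorem eventually_eq_of_ne_zero {t : ℝ} (ht : t ∈ Ico (0 : ℝ) 1) (hE : elE a b (U t) ≠ 0)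
    (hz : z t = elZ a b (U t)) (hy : y t = elY a b (U t)) (h0 : y t ≠ 0) :
    ∀ᶠ s in 𝓝[>] t, elE a b (U s) ≠ 0 ∧ z s = elZ a b (U s) ∧ y s = elY a b (U s) := by
  obtain ⟨tz, ty, tU⟩ := h.tendsto_right ht
  have hEn : ∀ᶠ u in 𝓝 (U t), elE a b u ≠ 0 :=
    (continuous_elE ha hb).continuousAt.eventually_ne hE
  have hYc : ContinuousAt (elY a b) (U t) := (hasDerivAt_elY ha hb hE).continuousAt
  obtain ⟨f, hf0, hfc, hf⟩ := exists_local_inverse (ch := elZ a b) (s := elY a b) (u₀ := U t)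
    (hEn.mono fun u hu => hasDerivAt_elZ ha hb hu) hYc (hy ▸ h0)
  rw [← hz] at hf0 hfc hf
  have hft : Tendsto (fun s => f (z s)) (𝓝[>] t) (𝓝 (U t)) := by
    have := hfc.tendsto.comp tz
    rwa [hf0] at this
  have hYf : Tendsto (fun s => elY a b (f (z s)) + y s) (𝓝[>] t) (𝓝 (y t + y t)) := by
    nth_rw 1 [hy]
    exact (hYc.tendsto.comp hft).add ty
  -- The curve equation fixes y only up to sign; the sum of the two candidates tends to 2y(t) ≠ 0,
  -- which excludes the minus sign.
  have hyf : ∀ᶠ s in 𝓝[>] t, y s = elY a b (f (z s)) := by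
    filter_upwards [hft.eventually hEn, tz.eventually hf, eventually_Ioo ht,
      hYf.eventually_ne (show y t + y t ≠ 0 by simpa [← two_mul] using h0)] with s h1 h2 h3 h4
    have h5 := elY_sq ha hb h1
    rw [h2.1, ← h.sq_eq s h3] at h5
    have : (elY a b (f (z s)) + y s) * (y s - elY a b (f (z s))) = 0 := by linear_combination -h5
    exact sub_eq_zero.1 ((mul_eq_zero.1 this).resolve_left h4)
  have hfU : ∀ᶠ s in 𝓝[>] t, f (z s) = U s := by
    refine eventually_eq_of_chart (s := elY a b) (κ' := deriv z) (U' := fun s => deriv z s / y s)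
      hf0 hfc (hf.mono fun x hx => hx.2) tz tU ?_ ?_ ?_
    · filter_upwards [eventually_Ioo ht] with s hs using (h.diff s hs).hasDerivAt
    · filter_upwards [eventually_Ioo ht] with s hs using h.deriv_U s hs
    · filter_upwards [eventually_Ioo ht, hyf] with s hs hs'
      have := h.ne_zero s hs
      rw [← hs']
      field_simp
  filter_upwards [hfU, hyf, tz.eventually hf, tU.eventually hEn] with s h1 h2 h3 h4
  rw [h1] at h2 h3
  exact ⟨h4, h3.1.symm, h2⟩

/-- At a branch point, such as the start of the path, Z' = 0 and z is no coordinate. But Y' = Z(2Z²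
+ b² - a²) ≠ 0 there, so y takes its place. -/
theorem eventually_eq_of_eq_zero {t : ℝ} (ht : t ∈ Ico (0 : ℝ) 1) (hE : elE a b (U t) ≠ 0)
    (hz : z t = elZ a b (U t)) (hy : y t = elY a b (U t)) (h0 : y t = 0) :
    ∀ᶠ s in 𝓝[>] t, elE a b (U s) ≠ 0 ∧ z s = elZ a b (U s) ∧ y s = elY a b (U s) := by
  obtain ⟨tz, ty, tU⟩ := h.tendsto_right ht
  have hEn : ∀ᶠ u in 𝓝 (U t), elE a b u ≠ 0 :=
    (continuous_elE ha hb).continuousAt.eventually_ne hE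
  have hZc : ContinuousAt (elZ a b) (U t) := (hasDerivAt_elZ ha hb hE).continuousAt
  have hsq := elY_sq ha hb hE
  rw [← hz, ← hy, h0, zero_pow two_ne_zero, eq_comm, mul_eq_zero] at hsq
  have haC : (a : ℂ) ^ 2 + b ^ 2 ≠ 0 := by
    norm_cast; positivity
  have hz2 : z t ≠ 0 := by
    intro hz0
    rcases hsq with hq | hq <;> simp [hz0, ha.ne', hb.ne'] at hq
  have hz3 : 2 * z t ^ 2 + b ^ 2 - a ^ 2 ≠ 0 := by
    intro hq'
    rcases hsq with hq | hq
    · exact haC (by linear_combination hq' - 2 * hq)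
    · exact haC (by linear_combination -hq' + 2 * hq)
  obtain ⟨f, hf0, hfc, hf⟩ := exists_local_inverse (ch := elY a b)
    (s := fun u => elZ a b u * (2 * elZ a b u ^ 2 + b ^ 2 - a ^ 2)) (u₀ := U t)
    (hEn.mono fun u hu => hasDerivAt_elY ha hb hu) (by fun_prop)
    (by rw [← hz]; exact mul_ne_zero hz2 hz3)
  rw [← hy] at hf0 hfc hf
  have hft : Tendsto (fun s => f (y s)) (𝓝[>] t) (𝓝 (U t)) := by
    have := hfc.tendsto.comp ty
    rwa [hf0] at this
  have hZf : Tendsto (fun s => elZ a b (f (y s))) (𝓝[>] t) (𝓝 (z t)) := by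
    rw [hz]
    exact hZc.tendsto.comp hft
  -- Equal values of y give (Z + z)(Z² + z² + b² - a²)(z - Z) = 0, and the first two factors have
  -- non-zero limits.
  have hzf : ∀ᶠ s in 𝓝[>] t, z s = elZ a b (f (y s)) := by
    have n1 := (hZf.add tz).eventually_ne (show z t + z t ≠ 0 by simpa [← two_mul] using hz2)
    have n2 := (((hZf.pow 2).add (tz.pow 2)).add_const ((b : ℂ) ^ 2 - a ^ 2)).eventually_ne
      (show z t ^ 2 + z t ^ 2 + (b ^ 2 - a ^ 2) ≠ 0 by convert hz3 using 1; ring)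
    filter_upwards [hft.eventually hEn, ty.eventually hf, eventually_Ioo ht, n1, n2]
      with s h1 h2 h3 h4 h5
    have h6 := elY_sq ha hb h1
    rw [h2.1, h.sq_eq s h3] at h6
    have : (elZ a b (f (y s)) + z s) * (elZ a b (f (y s)) ^ 2 + z s ^ 2 + (b ^ 2 - a ^ 2)) *
        (z s - elZ a b (f (y s))) = 0 := by linear_combination h6
    exact sub_eq_zero.1 ((mul_eq_zero.1 this).resolve_left (mul_ne_zero h4 h5))
  have hfU : ∀ᶠ s in 𝓝[>] t, f (y s) = U s := by
    refine eventually_eq_of_chart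
      (s := fun u => elZ a b u * (2 * elZ a b u ^ 2 + b ^ 2 - a ^ 2))
      (κ' := fun s => z s * (2 * z s ^ 2 + b ^ 2 - a ^ 2) * (deriv z s / y s))
      (U' := fun s => deriv z s / y s)
      hf0 hfc (hf.mono fun x hx => hx.2) ty tU ?_ ?_ ?_
    · filter_upwards [eventually_Ioo ht] with s hs using h.hasDerivAt_y hs
    · filter_upwards [eventually_Ioo ht] with s hs using h.deriv_U s hs
    · filter_upwards [hzf] with s hs
      rw [← hs]
  filter_upwards [hfU, hzf, ty.eventually hf, tU.eventually hEn] with s h1 h2 h3 h4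
  rw [h1] at h2 h3
  exact ⟨h4, h2, h3.1.symm⟩

/-- Uniformization: the integral of `dz / y` along a path determines its points. -/
theorem eq_elZ (hE0 : elE a b (U 0) ≠ 0) (hz0 : z 0 = elZ a b (U 0)) (hy0 : y 0 = elY a b (U 0))
    {t : ℝ} (ht : t ∈ Ico (0 : ℝ) 1) :
    elE a b (U t) ≠ 0 ∧ z t = elZ a b (U t) ∧ y t = elY a b (U t) := by
  -- Continuous induction: this set is closed in [0, t], and each of its points has a right
  -- neighborhood inside it.
  let S : Set ℝ := {t | elE a b (U t) ≠ 0 ∧ z t = elZ a b (U t) ∧ y t = elY a b (U t)}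
  have hsub : Icc 0 t ⊆ Ico (0 : ℝ) 1 := fun s hs => ⟨hs.1, hs.2.trans_lt ht.2⟩
  have hcl : IsClosed (S ∩ Icc 0 t) := by
    refine isClosed_iff_frequently.2 fun x hx => ?_
    have hxt : x ∈ Icc 0 t := by
      refine isClosed_Icc.mem_of_frequently_of_tendsto (hx.mono fun s hs => hs.2) tendsto_id
    have hx' := hsub hxt
    have tz := ((h.cont_z x hx').mono hsub).tendsto
    have ty := ((h.cont_y x hx').mono hsub).tendsto
    have tU := ((h.cont_U x hx').mono hsub).tendsto
    have hfr : ∃ᶠ s in 𝓝[Icc 0 t] x, s ∈ S := by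
      rw [frequently_nhdsWithin_iff]
      exact hx
    -- The identity passes to the limit and rules out a pole at x, where it would read 0 = a²(a² +
    -- b²).
    have hN : normSq (z x) * elE a b (U x) = a ^ 2 * elM a b (U x) := by
      refine tendsto_nhds_unique_of_frequently_eq
        ((continuous_normSq.tendsto _ |>.comp tz).mul
          ((continuous_elE ha hb).tendsto _ |>.comp tU))
        (((continuous_elM ha hb).tendsto _ |>.comp tU).const_mul (a ^ 2)) ?_
      refine hfr.mono fun s hs => ?_
      simp only [Function.comp_apply]
      rw [hs.2.1]
      exact normSq_elZ_mul_elE ha hb hs.1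
    have hE : elE a b (U x) ≠ 0 := by
      intro h0
      rw [h0, elM_of_elE_eq_zero ha hb h0, mul_zero] at hN
      have : 0 < a ^ 2 * (a ^ 2 + b ^ 2) := by positivity
      exact this.ne hN
    refine ⟨⟨hE, ?_, ?_⟩, hxt⟩
    · exact tendsto_nhds_unique_of_frequently_eq tz
        ((hasDerivAt_elZ ha hb hE).continuousAt.tendsto.comp tU) (hfr.mono fun s hs => hs.2.1)
    · exact tendsto_nhds_unique_of_frequently_eq ty
        ((hasDerivAt_elY ha hb hE).continuousAt.tendsto.comp tU) (hfr.mono fun s hs => hs.2.2)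
  refine hcl.Icc_subset_of_forall_mem_nhdsWithin ⟨hE0, hz0, hy0⟩ (fun x hx => ?_)
    (right_mem_Icc.2 ht.1)
  have hx' : x ∈ Ico (0 : ℝ) 1 := ⟨hx.2.1, hx.2.2.trans ht.2⟩
  obtain ⟨h1, h2, h3⟩ := hx.1
  by_cases h0 : y x = 0
  · exact h.eventually_eq_of_eq_zero ha hb hx' h1 h2 h3 h0
  · exact h.eventually_eq_of_ne_zero ha hb hx' h1 h2 h3 h0

end IsCurvePath


/-! ### The base point, the poles, and the ends of paths. -/

section

variable {a b : ℝ} (ha : 0 < a) (hb : 0 < b)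

include ha in
theorem am_zero : am a b 0 = 0 := by
  have := am_ellF b ha 0
  rwa [ellF_zero] at this

include ha hb

theorem elE_zero_ne_zero : elE a b 0 ≠ 0 := by
  have := jD_pos a hb 0
  simp [elE, jC, jS, am_zero ha, am_zero hb, this.ne']

theorem elZ_zero : elZ a b 0 = -a := by
  have h : elE a b 0 = a ^ 2 + b ^ 2 := by
    have := jD_sq a hb 0
    simp only [jC, am_zero hb, Real.cos_zero] at this
    simp [elE, jC, jS, am_zero ha, am_zero hb, this]
    ring
  have h0 : (a : ℂ) ^ 2 + b ^ 2 ≠ 0 := by norm_cast; positivity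
  rw [elZ, h]
  simp [jC, jS, am_zero ha, am_zero hb]
  field_simp

theorem elY_zero : elY a b 0 = 0 := by
  simp [elY, elG, jS, am_zero ha, am_zero hb]

theorem eq_of_elE_eq_zero {u : ℂ} (hu : elE a b u = 0) :
    ∃ m n : ℤ, u = (2 * m + 1) * quarter a b + 2 * n * quarter b a * I ∧
      jS a b u.re = (-1) ^ m ∧ jC b a u.im = (-1) ^ n := by
  obtain ⟨h1, h2⟩ := elE_eq_zero ha hb hu
  obtain ⟨m, hm, hm'⟩ := jC_eq_zero b ha h1
  obtain ⟨n, hn, hn'⟩ := jS_eq_zero a hb h2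
  refine ⟨m, n, ?_, hm', hn'⟩
  apply Complex.ext
  · simp [hm]
  · simp [hn]

theorem elE_pole (m n : ℤ) :
    elE a b ((2 * m + 1) * quarter a b + 2 * n * quarter b a * I) = 0 := by
  have h1 := jC_odd_mul_quarter b ha m
  have h2 := jS_even_mul_quarter a hb n
  simp [elE, h1, h2]

end

namespace IsCurvePath

variable {a b : ℝ} {z y U : ℝ → ℂ} (h : IsCurvePath a b z y U) (ha : 0 < a) (hb : 0 < b)
  (hE0 : elE a b (U 0) ≠ 0) (hz0 : z 0 = elZ a b (U 0)) (hy0 : y 0 = elY a b (U 0))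

include h ha hb hE0 hz0 hy0

theorem eventually_eq_elZ : ∀ᶠ t in 𝓝[<] (1 : ℝ),
    elE a b (U t) ≠ 0 ∧ z t = elZ a b (U t) ∧ y t = elY a b (U t) := by
  filter_upwards [Ioo_mem_nhdsLT (show (0 : ℝ) < 1 by norm_num)] with t ht
  exact h.eq_elZ ha hb hE0 hz0 hy0 ⟨ht.1.le, ht.2⟩

theorem eventually_normSq : ∀ᶠ t in 𝓝[<] (1 : ℝ),
    normSq (z t) * elE a b (U t) = a ^ 2 * elM a b (U t) := by
  filter_upwards [h.eventually_eq_elZ ha hb hE0 hz0 hy0] with t ht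
  rw [ht.2.1]
  exact normSq_elZ_mul_elE ha hb ht.1

theorem elE_ne_zero_of_tendsto {z₀ u : ℂ} (hz : Tendsto z (𝓝[<] 1) (𝓝 z₀))
    (hU : Tendsto U (𝓝[<] 1) (𝓝 u)) : elE a b u ≠ 0 := by
  intro h0
  have hN : normSq z₀ * elE a b u = a ^ 2 * elM a b u :=
    tendsto_nhds_unique_of_eventuallyEq
      (((continuous_normSq.tendsto _).comp hz).mul (((continuous_elE ha hb).tendsto _).comp hU))
      ((((continuous_elM ha hb).tendsto _).comp hU).const_mul (a ^ 2))
      (h.eventually_normSq ha hb hE0 hz0 hy0)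
  rw [h0, elM_of_elE_eq_zero ha hb h0, mul_zero] at hN
  have : 0 < a ^ 2 * (a ^ 2 + b ^ 2) := by positivity
  exact this.ne hN

theorem elE_eq_zero_of_tendsto {u : ℂ} (hz : Tendsto z (𝓝[<] 1) (Bornology.cobounded ℂ))
    (hU : Tendsto U (𝓝[<] 1) (𝓝 u)) : elE a b u = 0 := by
  by_contra h0
  have hE := ((continuous_elE ha hb).tendsto _).comp hU
  have hlim := ((((continuous_elM ha hb).tendsto _).comp hU).const_mul (a ^ 2)).div hE h0
  have hinf : Tendsto (fun t => normSq (z t)) (𝓝[<] 1) atTop := by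
    simp_rw [normSq_eq_norm_sq]
    exact (tendsto_pow_atTop two_ne_zero).comp (tendsto_norm_cobounded_atTop.comp hz)
  refine not_tendsto_nhds_of_tendsto_atTop hinf _ (hlim.congr' ?_)
  filter_upwards [h.eventually_normSq ha hb hE0 hz0 hy0, hE.eventually_ne h0] with t h1 h2
  rw [Pi.div_apply, Function.comp_apply, div_eq_iff h2, Function.comp_apply, h1]

/-- At the pole the identity of `re_elY_div_sq` becomes (-1)^k = -(-1)^m(-1)^n, after removal of the
common factor a(a² + b²)². -/
theorem exists_of_tendsto_infty {u : ℂ} {k : ℕ}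
    (hz : Tendsto z (𝓝[<] 1) (Bornology.cobounded ℂ))
    (hy : Tendsto (fun t => y t / z t ^ 2) (𝓝[<] 1) (𝓝 ((-1) ^ k)))
    (hU : Tendsto U (𝓝[<] 1) (𝓝 u)) :
    ∃ m n : ℤ, u = (2 * m + 1) * quarter a b + 2 * n * quarter b a * I ∧
      (-1 : ℝ) ^ k = -(-1) ^ (m + n) := by
  have h0 := h.elE_eq_zero_of_tendsto ha hb hE0 hz0 hy0 hz hU
  obtain ⟨m, n, hu, hm, hn⟩ := eq_of_elE_eq_zero ha hb h0
  refine ⟨m, n, hu, ?_⟩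
  have hM := elM_of_elE_eq_zero ha hb h0
  have hMne : elM a b u ≠ 0 := by rw [hM]; positivity
  have hMt := ((continuous_elM ha hb).tendsto _).comp hU
  have hc : Continuous fun u : ℂ => -((a ^ 2 + b ^ 2) * (jS a b u.re * jC b a u.im * jD a b u.re *
      (jD b a u.im ^ 2 + b ^ 2 * jC a b u.re ^ 2 * jS b a u.im ^ 2))) := by
    have h1 : Continuous (jC b a) := Real.continuous_cos.comp (continuous_am a hb)
    have h2 : Continuous (jC a b) := Real.continuous_cos.comp (continuous_am b ha)
    have h3 : Continuous (jS b a) := Real.continuous_sin.comp (continuous_am a hb)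
    have h4 : Continuous (jS a b) := Real.continuous_sin.comp (continuous_am b ha)
    unfold jD
    fun_prop
  have hlim := tendsto_nhds_unique_of_eventuallyEq
    (((continuous_re.tendsto _).comp hy).mul ((hMt.pow 2).const_mul a))
    ((hc.tendsto u).comp hU) (by
      filter_upwards [h.eventually_eq_elZ ha hb hE0 hz0 hy0, hMt.eventually_ne hMne] with t h1 h2
      simp only [Function.comp_apply]
      rw [h1.2.1, h1.2.2]
      exact re_elY_div_sq ha hb h1.1 h2)
  obtain ⟨e1, e2⟩ := elE_eq_zero ha hb h0
  have hD : jD a b u.re = a := by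
    rw [jD, e1]
    simp [Real.sqrt_sq ha.le]
  have hD1 := jD_sq a hb u.im
  have hC1 := jS_sq b a u.im
  rw [e2] at hC1
  have hre : ((-1 : ℂ) ^ k).re = (-1) ^ k := by
    have : ((-1 : ℂ) ^ k) = (((-1 : ℝ) ^ k : ℝ) : ℂ) := by simp
    rw [this, ofReal_re]
  rw [hre, hM, e1, e2, hm, hn, hD] at hlim
  have hpos : 0 < a * (a ^ 2 + b ^ 2) ^ 2 := by positivity
  refine mul_right_cancel₀ hpos.ne' ?_
  have hD2 : jD b a u.im ^ 2 = a ^ 2 + b ^ 2 := by linear_combination hD1 + a ^ 2 * hC1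
  rw [zpow_add₀ (by norm_num)]
  rw [hD2] at hlim
  linear_combination hlim

end IsCurvePath

/-! ### Endpoints of lifts and the values of Φ. -/

namespace IsLift

variable {a b : ℝ} {u φ : ℂ}

/-- Along a path, `Φ² = (2z² + b² - a² + 2y) / (a² + b²)`. -/
theorem exp_sq {z y U V : ℝ → ℂ}
    (h : IsCurvePath a b z y U) (hz0 : z 0 = -a) (hy0 : y 0 = 0) (hV0 : V 0 = 0)
    (hV : ContinuousOn V (Ico 0 1))
    (hVd : ∀ t ∈ Ioo (0 : ℝ) 1, HasDerivAt V (z t * deriv z t / y t) t)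
    {t : ℝ} (ht : t ∈ Ioo (0 : ℝ) 1) :
    (a ^ 2 + b ^ 2) * exp (V t) ^ 2 = 2 * z t ^ 2 + b ^ 2 - a ^ 2 + 2 * y t := by
  -- The logarithmic derivative of 2z² + b² - a² + 2y is 2zz'/y = 2V', so this product is constant;
  -- at the start, where z = -a and y = V = 0, it equals a² + b².
  have hd : ∀ s ∈ Ioo (0 : ℝ) 1, HasDerivAt
      (fun t => exp (-2 * V t) * (2 * z t ^ 2 + b ^ 2 - a ^ 2 + 2 * y t)) 0 s := fun s hs => by
    have hy := h.ne_zero s hs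
    have h1 := ((hVd s hs).const_mul (-2)).cexp
    have h2 := ((((((h.diff s hs).hasDerivAt.fun_pow 2).const_mul (2 : ℂ)).add_const
      ((b : ℂ) ^ 2)).sub_const ((a : ℂ) ^ 2))).add ((h.hasDerivAt_y hs).const_mul (2 : ℂ))
    refine (h1.mul h2).congr_deriv ?_
    push_cast
    simp only [Pi.add_apply]
    field_simp
    ring
  have hc : ContinuousOn (fun t => exp (-2 * V t) * (2 * z t ^ 2 + b ^ 2 - a ^ 2 + 2 * y t))
      (Ico 0 1) := by
    have := h.cont_z
    have := h.cont_y
    fun_prop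
  have hconst : exp (-2 * V t) * (2 * z t ^ 2 + b ^ 2 - a ^ 2 + 2 * y t) = a ^ 2 + b ^ 2 := by
    refine eq_of_hasDerivAt_zero ?_ hd ht
    have h0 : (0 : ℝ) ∈ Ico (0 : ℝ) 1 := by simp
    have h1 := (hc 0 h0).tendsto
    simp only [hz0, hy0, hV0] at h1
    have h2 : 𝓝[>] (0 : ℝ) ≤ 𝓝[Ico 0 1] 0 := by
      rw [← nhdsWithin_Ioo_eq_nhdsGT zero_lt_one]
      exact nhdsWithin_mono _ Ioo_subset_Ico_self
    convert h1.mono_left h2 using 2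
    simp
    ring
  rw [← hconst, mul_right_comm, ← exp_nat_mul, ← exp_add]
  simp

/-- The path of a lift, with the unnormalized integral. -/
theorem exists_path (ha : 0 < a) (hb : 0 < b) (hα : alphaPeriod a b ≠ 0) {p : Surface a b}
    (h : IsLift p u φ) : ∃ z y U V : ℝ → ℂ, IsCurvePath a b z y U ∧
      (elE a b (U 0) ≠ 0 ∧ z 0 = elZ a b (U 0) ∧ y 0 = elY a b (U 0)) ∧
      (∀ t ∈ Ioo (0 : ℝ) 1,
        (a ^ 2 + b ^ 2) * exp (V t) ^ 2 = 2 * z t ^ 2 + b ^ 2 - a ^ 2 + 2 * y t) ∧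
      ConvergesTo z y p ∧ Tendsto U (𝓝[<] 1) (𝓝 (alphaPeriod a b * u)) ∧
      (p ≠ .infty 0 → Tendsto (fun t => exp (V t)) (𝓝[<] 1) (𝓝 φ)) := by
  obtain ⟨z, y, U, V, hz, hy, hU, hV, hz0, hy0, hU0, hV0, hd, hp, hu, hφ⟩ := h
  have hpath : IsCurvePath a b z y fun t => alphaPeriod a b * U t := by
    refine ⟨hz, hy, hU.const_mul _, fun t ht => (hd t ht).1, fun t ht => (hd t ht).2.1,
      fun t ht => (hd t ht).2.2.2.1, fun t ht => ?_⟩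
    refine ((hd t ht).2.2.2.2.1.const_mul (alphaPeriod a b)).congr_deriv ?_
    rw [mul_inv_cancel_left₀ hα]
  refine ⟨z, y, _, V, hpath, ?_, fun t ht => ?_, hp, hu.const_mul _, hφ⟩
  · simp only [hU0, mul_zero, hz0, hy0, elZ_zero ha hb, elY_zero ha hb, and_self, and_true]
    exact elE_zero_ne_zero ha hb
  · exact exp_sq hpath hz0 hy0 hV0 hV (fun t ht => (hd t ht).2.2.2.2.2) ht

/-- The first conclusion serves to exclude finite endpoints, the second to find Φ at a point over 0
up to sign. -/
theorem affine (ha : 0 < a) (hb : 0 < b) (hα : alphaPeriod a b ≠ 0) {z₀ y₀ : ℂ}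
    {hp : y₀ ^ 2 = (z₀ ^ 2 - (a : ℂ) ^ 2) * (z₀ ^ 2 + (b : ℂ) ^ 2)}
    (h : IsLift (.affine z₀ y₀ hp) u φ) : elE a b (alphaPeriod a b * u) ≠ 0 ∧
      (a ^ 2 + b ^ 2) * φ ^ 2 = 2 * z₀ ^ 2 + b ^ 2 - a ^ 2 + 2 * y₀ := by
  obtain ⟨z, y, U, V, h, ⟨hE, hz0, hy0⟩, hV, hc, hu, hφ⟩ := h.exists_path ha hb hα
  have hφ := hφ (by simp)
  refine ⟨h.elE_ne_zero_of_tendsto ha hb hE hz0 hy0 hc.1 hu, ?_⟩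
  refine tendsto_nhds_unique_of_eventuallyEq ((hφ.pow 2).const_mul _)
    (((((hc.1.pow 2).const_mul 2).add_const _).sub_const _).add (hc.2.const_mul 2)) ?_
  filter_upwards [Ioo_mem_nhdsLT (show (0 : ℝ) < 1 by norm_num)] with t ht using hV t ht

theorem infty (ha : 0 < a) (hb : 0 < b) (hα : alphaPeriod a b ≠ 0) {k : Fin 2}
    (h : IsLift (.infty k : Surface a b) u φ) : ∃ m n : ℤ,
      alphaPeriod a b * u = (2 * m + 1) * quarter a b + 2 * n * quarter b a * I ∧
        (-1 : ℝ) ^ k.val = -(-1) ^ (m + n) := by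
  obtain ⟨z, y, U, V, h, ⟨hE, hz0, hy0⟩, hV, hc, hu, hφ⟩ := h.exists_path ha hb hα
  exact h.exists_of_tendsto_infty ha hb hE hz0 hy0 hc.1 hc.2 hu

/-- As (2z² + b² - a²)² - 4y² = (a² + b²)², the product of Φ² and (2z² + b² - a² - 2y)/z² is (a² +
b²)/z². On the sheet 1 the second factor tends to 4 and the product to 0. -/
theorem infty_one (ha : 0 < a) (hb : 0 < b) (hα : alphaPeriod a b ≠ 0)
    (h : IsLift (.infty 1 : Surface a b) u φ) : φ = 0 := by
  obtain ⟨z, y, U, V, h, -, hV, hc, hu, hφ⟩ := h.exists_path ha hb hα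
  have hφ := hφ (by simp)
  have hlam : (a : ℂ) ^ 2 + b ^ 2 ≠ 0 := by norm_cast; positivity
  have hz2 : Tendsto (fun t => (z t ^ 2)⁻¹) (𝓝[<] 1) (𝓝 0) := by
    have := (tendsto_inv₀_cobounded.comp hc.1).pow 2
    simpa using this
  have hlim : Tendsto (fun t => exp (V t) ^ 2 *
      (2 + (b ^ 2 - a ^ 2) * (z t ^ 2)⁻¹ - 2 * (y t / z t ^ 2))) (𝓝[<] 1) (𝓝 (φ ^ 2 * 4)) := by
    have := (hφ.pow 2).mul ((((hz2.const_mul ((b : ℂ) ^ 2 - a ^ 2)).const_add 2)).sub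
      (hc.2.const_mul 2))
    convert this using 2
    norm_num
  have hlim0 : Tendsto (fun t => ((a : ℂ) ^ 2 + b ^ 2) * (z t ^ 2)⁻¹) (𝓝[<] 1) (𝓝 0) := by
    simpa using hz2.const_mul ((a : ℂ) ^ 2 + b ^ 2)
  have hz : ∀ᶠ t in 𝓝[<] (1 : ℝ), z t ≠ 0 := by
    have := hc.1.eventually (Bornology.le_cofinite ℂ (Set.finite_singleton 0).compl_mem_cofinite)
    exact this
  have h0 := tendsto_nhds_unique_of_eventuallyEq hlim hlim0 (by
    filter_upwards [Ioo_mem_nhdsLT (show (0 : ℝ) < 1 by norm_num), hz] with t ht hzt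
    have h1 := hV t ht
    have h2 := h.sq_eq t ht
    refine mul_left_cancel₀ hlam ?_
    rw [← mul_assoc, h1]
    field_simp
    linear_combination (-4) * h2)
  simpa using h0

end IsLift


/-! ### The branch w in the fourth quadrant and integrability of 1/w. -/

theorem cpow_half_sq (x : ℂ) : (x ^ (1 / 2 : ℂ)) ^ 2 = x := by
  rw [one_div]
  exact cpow_ofNat_inv_pow x 2

theorem re_cpow_half_pos {x : ℂ} (hx : x ∈ slitPlane) : 0 < (x ^ (1 / 2 : ℂ)).re := by
  have h0 := slitPlane_ne_zero hx
  rw [cpow_def_of_ne_zero h0, exp_re]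
  refine mul_pos (Real.exp_pos _) (Real.cos_pos_of_mem_Ioo ?_)
  have him : (log x * (1 / 2)).im = x.arg / 2 := by
    rw [show log x * (1 / 2) = (1 / 2 : ℝ) * log x by push_cast; ring, im_ofReal_mul, log_im]; ring
  have h1 := neg_pi_lt_arg x
  have h2 := lt_of_le_of_ne (arg_le_pi x) (slitPlane_arg_ne_pi hx)
  rw [him]
  constructor <;> linarith

theorem w_sq (a b : ℝ) {z : ℂ} (hz : z ≠ 0) :
    w a b z ^ 2 = (z ^ 2 - (a : ℂ) ^ 2) * (z ^ 2 + (b : ℂ) ^ 2) := by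
  rw [w, mul_pow, mul_pow, cpow_half_sq, cpow_half_sq]
  field_simp

section

variable {a b : ℝ} (ha : 0 < a) (hb : 0 < b) {z : ℂ} (h1 : 0 < z.re) (h2 : z.im < 0)

include h1 in
theorem ne_zero_of_re_pos : z ≠ 0 := fun h => by simp [h] at h1

include h1 h2

theorem im_inv_sq_pos : 0 < (1 / z ^ 2).im := by
  have hz : 0 < normSq (z ^ 2) :=
    normSq_pos.2 (pow_ne_zero 2 (ne_zero_of_re_pos h1))
  rw [one_div, inv_im]
  refine div_pos ?_ hz
  rw [sq, mul_im]
  nlinarith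

include ha in
theorem im_factor_neg : (1 - (a : ℂ) ^ 2 / z ^ 2).im < 0 := by
  have h := im_inv_sq_pos h1 h2
  rw [show (1 : ℂ) - (a : ℂ) ^ 2 / z ^ 2 = 1 - (a ^ 2 : ℝ) * (1 / z ^ 2) by push_cast; ring, sub_im,
    im_ofReal_mul, one_im]
  have := mul_pos (pow_pos ha 2) h
  linarith

include hb in
theorem im_factor_pos : 0 < (1 + (b : ℂ) ^ 2 / z ^ 2).im := by
  have h := im_inv_sq_pos h1 h2
  rw [show (1 : ℂ) + (b : ℂ) ^ 2 / z ^ 2 = 1 + (b ^ 2 : ℝ) * (1 / z ^ 2) by push_cast; ring, add_im,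
    im_ofReal_mul, one_im]
  have := mul_pos (pow_pos hb 2) h
  linarith

include ha hb

theorem continuousAt_w : ContinuousAt (w a b) z := by
  have hz := ne_zero_of_re_pos h1
  have e1 : 1 - (a : ℂ) ^ 2 / z ^ 2 ∈ slitPlane := Or.inr (im_factor_neg ha h1 h2).ne
  have e2 : 1 + (b : ℂ) ^ 2 / z ^ 2 ∈ slitPlane := Or.inr (im_factor_pos hb h1 h2).ne'
  have hz2 : z ^ 2 ≠ 0 := pow_ne_zero 2 hz
  have c1 : ContinuousAt (fun z : ℂ => 1 - (a : ℂ) ^ 2 / z ^ 2) z := by fun_prop (disch := assumption)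
  have c2 : ContinuousAt (fun z : ℂ => 1 + (b : ℂ) ^ 2 / z ^ 2) z := by fun_prop (disch := assumption)
  exact ((continuousAt_id.pow 2).mul (c1.cpow continuousAt_const e1)).mul
    (c2.cpow continuousAt_const e2)

/-- Both square roots have positive real parts, and their imaginary parts have opposite signs, so
both terms of the real part of the product are positive. Compared with `re_elY_div_sq`, this sign
identifies the sheet. -/
theorem re_w_div_sq_pos : 0 < (w a b z / z ^ 2).re := by
  have hz := ne_zero_of_re_pos h1
  have i1 := im_factor_neg ha h1 h2
  have i2 := im_factor_pos hb h1 h2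
  have r1 := re_cpow_half_pos (Or.inr i1.ne : 1 - (a : ℂ) ^ 2 / z ^ 2 ∈ slitPlane)
  have r2 := re_cpow_half_pos (Or.inr i2.ne' : 1 + (b : ℂ) ^ 2 / z ^ 2 ∈ slitPlane)
  have s1 := cpow_half_sq (1 - (a : ℂ) ^ 2 / z ^ 2)
  have s2 := cpow_half_sq (1 + (b : ℂ) ^ 2 / z ^ 2)
  have hw : w a b z / z ^ 2 = (1 - (a : ℂ) ^ 2 / z ^ 2) ^ (1 / 2 : ℂ) *
      (1 + (b : ℂ) ^ 2 / z ^ 2) ^ (1 / 2 : ℂ) := by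
    rw [w]; field_simp
  rw [hw]
  generalize (1 - (a : ℂ) ^ 2 / z ^ 2) ^ (1 / 2 : ℂ) = p at *
  generalize (1 + (b : ℂ) ^ 2 / z ^ 2) ^ (1 / 2 : ℂ) = q at *
  rw [← s1, sq, mul_im] at i1
  rw [← s2, sq, mul_im] at i2
  have j1 : p.im < 0 := by nlinarith
  have j2 : 0 < q.im := by nlinarith
  rw [mul_re]
  nlinarith [mul_pos r1 r2, mul_pos (neg_pos.2 j1) j2]

/-- Conjugation carries the β-integral in the first quadrant to the α-integral in the fourth. -/
theorem w_conj : w a b (starRingEnd ℂ z) = starRingEnd ℂ (w a b z) := by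
  have e1 : (1 - (a : ℂ) ^ 2 / z ^ 2).arg ≠ Real.pi :=
    slitPlane_arg_ne_pi (Or.inr (im_factor_neg ha h1 h2).ne)
  have e2 : (1 + (b : ℂ) ^ 2 / z ^ 2).arg ≠ Real.pi :=
    slitPlane_arg_ne_pi (Or.inr (im_factor_pos hb h1 h2).ne')
  have c1 := conj_cpow _ (1 / 2) e1
  have c2 := conj_cpow _ (1 / 2) e2
  have hh : starRingEnd ℂ (1 / 2) = 1 / 2 := by simp [map_ofNat]
  rw [hh] at c1 c2
  simp only [w, map_mul, map_pow, ← c1, ← c2, map_sub, map_add, map_div₀, map_one, conj_ofReal]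

end

/-- The segment from `-ib` to `a`. -/
noncomputable def alphaSeg (a b t : ℝ) : ℂ := corner a b 3 + t * (corner a b 0 - corner a b 3)

/-- The integrand of the `α`-period. -/
noncomputable def alphaIntegrand (a b t : ℝ) : ℂ :=
  1 / w a b (alphaSeg a b t) * (corner a b 0 - corner a b 3)

theorem alphaPeriod_eq (a b : ℝ) : alphaPeriod a b = 2 * ∫ t in (0 : ℝ)..1, alphaIntegrand a b t :=
  rfl

section

variable {a b : ℝ} (ha : 0 < a) (hb : 0 < b)

theorem alphaSeg_eq (a b t : ℝ) : alphaSeg a b t = (t * a : ℝ) + (-(1 - t) * b : ℝ) * I := by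
  simp [alphaSeg, corner]
  ring

theorem continuous_alphaSeg (a b : ℝ) : Continuous (alphaSeg a b) := by
  unfold alphaSeg
  fun_prop

theorem alphaSeg_re (a b t : ℝ) : (alphaSeg a b t).re = t * a := by
  rw [alphaSeg_eq]; simp

theorem alphaSeg_im (a b t : ℝ) : (alphaSeg a b t).im = -(1 - t) * b := by
  rw [alphaSeg_eq]; simp

include ha in
theorem alphaSeg_re_pos {t : ℝ} (ht : t ∈ Ioo (0 : ℝ) 1) : 0 < (alphaSeg a b t).re := by
  rw [alphaSeg_re]; exact mul_pos ht.1 ha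

include hb in
theorem alphaSeg_im_neg {t : ℝ} (ht : t ∈ Ioo (0 : ℝ) 1) : (alphaSeg a b t).im < 0 := by
  rw [alphaSeg_im]
  have := mul_pos (sub_pos.2 ht.2) hb
  linarith

include ha hb

theorem alphaSeg_ne_zero (t : ℝ) : alphaSeg a b t ≠ 0 := fun h => by
  have h1 := alphaSeg_re a b t
  have h2 := alphaSeg_im a b t
  rw [h] at h1 h2
  simp [ha.ne', hb.ne'] at h1 h2
  linarith

theorem continuousOn_w_alphaSeg : ContinuousOn (fun t => w a b (alphaSeg a b t)) (Ioo 0 1) :=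
  fun _ ht => ((continuousAt_w ha hb (alphaSeg_re_pos ha ht) (alphaSeg_im_neg hb ht)).comp
    (continuous_alphaSeg a b).continuousAt).continuousWithinAt

/-- On the segment (z - a)(z + ib) = -t(1 - t)(a + ib)², while |z + a| ≥ a and |z - ib| ≥ b. So 1/w
has at most inverse square root singularities at the ends. -/
theorem norm_w_alphaSeg_sq {t : ℝ} (ht : t ∈ Ioo (0 : ℝ) 1) :
    t * (1 - t) * ((a ^ 2 + b ^ 2) * (a * b)) ≤ ‖w a b (alphaSeg a b t)‖ ^ 2 := by
  have hr := alphaSeg_re_pos (b := b) ha ht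
  have hi := alphaSeg_im_neg (a := a) hb ht
  have e : w a b (alphaSeg a b t) ^ 2 = -(t * (1 - t) : ℝ) * (a + b * I) ^ 2 *
      ((alphaSeg a b t + a) * (alphaSeg a b t - b * I)) := by
    rw [w_sq a b (alphaSeg_ne_zero ha hb t), alphaSeg_eq]
    push_cast
    grind [I_sq]
  have n1 : a ≤ ‖alphaSeg a b t + a‖ := by
    refine le_trans ?_ (re_le_norm _)
    simp; exact hr.le
  have n2 : b ≤ ‖alphaSeg a b t - b * I‖ := by
    refine le_trans ?_ ((le_abs_self _).trans (abs_im_le_norm _ |>.trans_eq (norm_neg _)))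
    simp; linarith
  have n3 : ‖(a : ℂ) + b * I‖ ^ 2 = a ^ 2 + b ^ 2 := by
    rw [← normSq_eq_norm_sq, normSq_add_mul_I]
  have n4 : 0 < t * (1 - t) := mul_pos ht.1 (sub_pos.2 ht.2)
  rw [← norm_pow, e, norm_mul, norm_mul, norm_mul, norm_pow, n3, norm_neg, norm_real,
    Real.norm_of_nonneg n4.le, ← mul_assoc]
  exact mul_le_mul_of_nonneg_left (mul_le_mul n1 n2 hb.le (norm_nonneg _))
    (mul_nonneg n4.le (by positivity))

theorem w_alphaSeg_ne_zero {t : ℝ} (ht : t ∈ Ioo (0 : ℝ) 1) : w a b (alphaSeg a b t) ≠ 0 := fun h => by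
  have := norm_w_alphaSeg_sq ha hb ht
  rw [h, norm_zero] at this
  have h1 : 0 < t * (1 - t) := mul_pos ht.1 (sub_pos.2 ht.2)
  have h2 : 0 < t * (1 - t) * ((a ^ 2 + b ^ 2) * (a * b)) := by positivity
  norm_num at this
  linarith

theorem continuousOn_alphaIntegrand : ContinuousOn (alphaIntegrand a b) (Ioo 0 1) :=
  (continuousOn_const.div (continuousOn_w_alphaSeg ha hb) fun _ ht =>
    w_alphaSeg_ne_zero ha hb ht).mul continuousOn_const

theorem intervalIntegrable_alphaIntegrand :
    IntervalIntegrable (alphaIntegrand a b) MeasureTheory.volume 0 1 := by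
  -- The majorant is a multiple of t^(-1/2)(1 - t)^(-1/2), the integrand of the Beta integral B(1/2,
  -- 1/2).
  have hg := ((betaIntegral_convergent (u := 1 / 2) (v := 1 / 2) (by norm_num) (by norm_num)).norm).const_mul
    (1 / √(a * b))
  rw [intervalIntegrable_iff_integrableOn_Ioo_of_le zero_le_one] at hg ⊢
  refine MeasureTheory.Integrable.mono' hg
    ((continuousOn_alphaIntegrand ha hb).aestronglyMeasurable measurableSet_Ioo) ?_
  rw [MeasureTheory.ae_restrict_iff' measurableSet_Ioo]
  refine Eventually.of_forall fun t ht => ?_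
  have h1 : 0 < 1 - t := sub_pos.2 ht.2
  have ht0 := ht.1
  have e : ‖(t : ℂ) ^ ((1 : ℂ) / 2 - 1) * (1 - t : ℂ) ^ ((1 : ℂ) / 2 - 1)‖ = (√(t * (1 - t)))⁻¹ := by
    rw [norm_mul, norm_cpow_eq_rpow_re_of_pos ht.1, ← ofReal_one, ← ofReal_sub,
      norm_cpow_eq_rpow_re_of_pos h1, Real.sqrt_eq_rpow, ← Real.rpow_neg (by positivity),
      Real.mul_rpow ht.1.le h1.le]
    norm_num
  rw [e]
  have hw := w_alphaSeg_ne_zero ha hb ht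
  have hn : ‖corner a b 0 - corner a b 3‖ = √(a ^ 2 + b ^ 2) := by
    rw [← norm_add_mul_I]
    simp [corner, mul_comm]
  have hle : √(t * (1 - t)) * (√(a ^ 2 + b ^ 2) * √(a * b)) ≤ ‖w a b (alphaSeg a b t)‖ := by
    rw [← Real.sqrt_mul (by positivity), ← Real.sqrt_mul (by positivity)]
    exact Real.sqrt_le_iff.2 ⟨norm_nonneg _, norm_w_alphaSeg_sq ha hb ht⟩
  have p1 : 0 < √(t * (1 - t)) := by positivity
  have p2 : 0 < √(a * b) := by positivity
  rw [alphaIntegrand, norm_mul, hn, norm_div, norm_one, one_div_mul_eq_div,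
    div_le_iff₀ (norm_pos_iff.2 hw)]
  calc √(a ^ 2 + b ^ 2) = 1 / √(a * b) * (√(t * (1 - t)))⁻¹ *
        (√(t * (1 - t)) * (√(a ^ 2 + b ^ 2) * √(a * b))) := by field_simp
    _ ≤ _ := by gcongr

end


/-! ### The periods of dz/w. -/

/-- A real function that starts positive and does not vanish stays positive. -/
theorem pos_of_ne_zero {f : ℝ → ℝ} (hf : ContinuousOn f (Ico 0 1)) (h0 : 0 < f 0)
    (hne : ∀ t ∈ Ioo (0 : ℝ) 1, f t ≠ 0) {t : ℝ} (ht : t ∈ Ico (0 : ℝ) 1) : 0 < f t := by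
  by_contra! hle
  obtain ⟨s, hs, hs0⟩ := intermediate_value_Icc' ht.1
    (hf.mono fun s hs => ⟨hs.1, hs.2.trans_lt ht.2⟩) (show (0 : ℝ) ∈ Icc (f t) (f 0) from ⟨hle, h0.le⟩)
  rcases hs.1.eq_or_lt with h | h
  · rw [← h] at hs0; exact h0.ne' hs0
  · exact hne s ⟨h, hs.2.trans_lt ht.2⟩ hs0

section

variable {a b : ℝ} (ha : 0 < a) (hb : 0 < b)

/-- The integral of `dz / w` along the segment from `-ib`, with the initial value belonging to the
parameter of `-ib`. -/
noncomputable def alphaPrimitive (a b t : ℝ) : ℂ :=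
  quarter a b + quarter b a * I + ∫ s in (0 : ℝ)..t, alphaIntegrand a b s

include ha hb

theorem continuousOn_alphaPrimitive : ContinuousOn (alphaPrimitive a b) (Icc 0 1) := by
  have h := intervalIntegral.continuousOn_primitive_interval'
    (intervalIntegrable_alphaIntegrand ha hb) left_mem_uIcc
  rw [uIcc_of_le zero_le_one] at h
  exact continuousOn_const.add h

theorem hasDerivAt_alphaPrimitive {t : ℝ} (ht : t ∈ Ioo (0 : ℝ) 1) :
    HasDerivAt (alphaPrimitive a b) (alphaIntegrand a b t) t := by
  have hc := continuousOn_alphaIntegrand ha hb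
  refine (intervalIntegral.integral_hasDerivAt_right
    ((intervalIntegrable_alphaIntegrand ha hb).mono_set ?_)
    (hc.stronglyMeasurableAtFilter isOpen_Ioo t ht)
    (hc.continuousAt (Ioo_mem_nhds ht.1 ht.2))).const_add _
  rw [uIcc_of_le zero_le_one, uIcc_of_le ht.1.le]
  exact Icc_subset_Icc_right ht.2.le

omit hb in
theorem jacobi_quarter : jC a b (quarter a b) = 0 ∧ jS a b (quarter a b) = 1 ∧
    jD a b (quarter a b) = a := by
  have h : jC a b (quarter a b) = 0 := by
    rw [jC, quarter, am_ellF b ha, Real.cos_pi_div_two]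
  refine ⟨h, ?_, ?_⟩
  · rw [jS, quarter, am_ellF b ha, Real.sin_pi_div_two]
  · rw [jD, h]; simp [Real.sqrt_sq ha.le]

theorem elliptic_at_corner :
    elE a b (quarter a b + quarter b a * I) ≠ 0 ∧
    elZ a b (quarter a b + quarter b a * I) = corner a b 3 ∧
    elY a b (quarter a b + quarter b a * I) = 0 := by
  obtain ⟨h1, h2, h3⟩ := jacobi_quarter (b := b) ha
  obtain ⟨k1, k2, k3⟩ := jacobi_quarter (b := a) hb
  have hE : elE a b (quarter a b + quarter b a * I) = a ^ 2 := by
    simp [elE, h1, k2]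
  have hE0 : elE a b (quarter a b + quarter b a * I) ≠ 0 := by rw [hE]; positivity
  have ha' : (a : ℂ) ≠ 0 := ofReal_ne_zero.2 ha.ne'
  have hZ : elZ a b (quarter a b + quarter b a * I) = corner a b 3 := by
    rw [elZ, hE]
    simp [h1, h2, h3, k2, k3, corner]
    field_simp
  refine ⟨hE0, hZ, ?_⟩
  have := elY_sq ha hb hE0
  rw [hZ] at this
  refine pow_eq_zero_iff two_ne_zero |>.1 (this.trans ?_)
  simp [corner, mul_pow]

theorem isCurvePath_alphaSeg :
    IsCurvePath a b (alphaSeg a b) (fun t => w a b (alphaSeg a b t)) (alphaPrimitive a b) := by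
  have hder : ∀ t, HasDerivAt (alphaSeg a b) (corner a b 0 - corner a b 3) t := fun t => by
    have := ((hasDerivAt_id t).ofReal_comp.mul_const (corner a b 0 - corner a b 3)).const_add
      (corner a b 3)
    rw [ofReal_one, one_mul] at this
    exact this
  refine ⟨(continuous_alphaSeg a b).continuousOn, ?_,
    (continuousOn_alphaPrimitive ha hb).mono Ico_subset_Icc_self,
    fun t _ => w_sq a b (alphaSeg_ne_zero ha hb t), fun t ht => w_alphaSeg_ne_zero ha hb ht,
    fun t _ => (hder t).differentiableAt, fun t ht => ?_⟩
  · intro t ht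
    rcases ht.1.eq_or_lt with rfl | h0
    -- At -ib the function w vanishes, so continuity of |w|, the root of the modulus of a
    -- polynomial, suffices there.
    · have hn : ∀ s, ‖w a b (alphaSeg a b s)‖ =
          √‖(alphaSeg a b s ^ 2 - (a : ℂ) ^ 2) * (alphaSeg a b s ^ 2 + (b : ℂ) ^ 2)‖ := fun s => by
        rw [← w_sq a b (alphaSeg_ne_zero ha hb s), norm_pow, Real.sqrt_sq (norm_nonneg _)]
      have hz : alphaSeg a b 0 = -(I * b) := by simp [alphaSeg, corner]
      have hw : w a b (alphaSeg a b 0) = 0 := by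
        rw [← norm_eq_zero, hn, hz]
        simp [mul_pow]
      have hc : Continuous fun s => ‖w a b (alphaSeg a b s)‖ := by
        have := continuous_alphaSeg a b
        simp_rw [hn]
        fun_prop
      refine ContinuousAt.continuousWithinAt ?_
      rw [ContinuousAt, hw, tendsto_zero_iff_norm_tendsto_zero]
      have := hc.tendsto 0
      rwa [hw, norm_zero] at this
    · exact ((continuousOn_w_alphaSeg ha hb).continuousAt
        (Ioo_mem_nhds h0 ht.2)).continuousWithinAt
  · refine (hasDerivAt_alphaPrimitive ha hb ht).congr_deriv ?_
    rw [(hder t).deriv, alphaIntegrand]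
    ring

theorem alphaPrimitive_spec {t : ℝ} (ht : t ∈ Ico (0 : ℝ) 1) :
    elE a b (alphaPrimitive a b t) ≠ 0 ∧ alphaSeg a b t = elZ a b (alphaPrimitive a b t) ∧
      w a b (alphaSeg a b t) = elY a b (alphaPrimitive a b t) := by
  obtain ⟨h1, h2, h3⟩ := elliptic_at_corner ha hb
  have hz : alphaSeg a b 0 = corner a b 3 := by simp [alphaSeg]
  have hU : alphaPrimitive a b 0 = quarter a b + quarter b a * I := by simp [alphaPrimitive]
  refine (isCurvePath_alphaSeg ha hb).eq_elZ ha hb (by rwa [hU]) (by rw [hU, h2, hz]) ?_ ht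
  rw [hU, h3, ← pow_eq_zero_iff two_ne_zero, w_sq a b (alphaSeg_ne_zero ha hb 0), hz]
  simp [corner, mul_pow]

omit ha hb in
theorem elE_nonneg (u : ℂ) : 0 ≤ elE a b u := by
  unfold elE; positivity

omit ha hb in
theorem elZ_re_im {u : ℂ} (hu : elE a b u ≠ 0) :
    (elZ a b u).re * elE a b u = -(a * (a ^ 2 + b ^ 2) * (jC a b u.re * jC b a u.im)) ∧
    (elZ a b u).im * elE a b u =
      -(a * (jS a b u.re * jS b a u.im) * (jD a b u.re * jD b a u.im)) := by
  have h := elZ_mul_elE hu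
  constructor
  · have := congrArg re h
    rw [re_mul_ofReal] at this
    rw [this]
    simp [← ofReal_pow]
    ring
  · have := congrArg im h
    rw [im_mul_ofReal] at this
    rw [this]
    simp [← ofReal_pow]
    ring

/-- The three signs encode Re z > 0, Im z < 0 and, through Re(w/z²) > 0, the sheet. -/
theorem alphaPrimitive_signs {t : ℝ} (ht : t ∈ Ioo (0 : ℝ) 1) :
    jC a b (alphaPrimitive a b t).re * jC b a (alphaPrimitive a b t).im < 0 ∧
    0 < jS a b (alphaPrimitive a b t).re * jS b a (alphaPrimitive a b t).im ∧
    jS a b (alphaPrimitive a b t).re * jC b a (alphaPrimitive a b t).im < 0 := by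
  obtain ⟨hE, hz, hy⟩ := alphaPrimitive_spec ha hb (Ioo_subset_Ico_self ht)
  have hr := alphaSeg_re_pos (b := b) ha ht
  have hi := alphaSeg_im_neg (a := a) hb ht
  have hw := re_w_div_sq_pos ha hb hr hi
  rw [hy, hz] at hw
  rw [hz] at hr hi
  set u := alphaPrimitive a b t
  have hEp : 0 < elE a b u := (elE_nonneg u).lt_of_ne' hE
  obtain ⟨e1, e2⟩ := elZ_re_im hE
  have hM : elM a b u ≠ 0 := by
    intro h0
    have := normSq_elZ_mul_elE ha hb hE
    rw [h0, mul_zero, mul_eq_zero, or_iff_left hE, normSq_eq_zero] at this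
    rw [this] at hr
    simp at hr
  have e3 := re_elY_div_sq ha hb hE hM
  have hD := jD_pos b ha u.re
  have hD1 := jD_pos a hb u.im
  have p1 := mul_pos hr hEp
  have p2 := mul_neg_of_neg_of_pos hi hEp
  have p3 := mul_pos hw (by positivity : 0 < a * elM a b u ^ 2)
  rw [e1] at p1
  rw [e2] at p2
  rw [e3] at p3
  refine ⟨?_, ?_, ?_⟩
  · by_contra! h
    have : 0 ≤ a * (a ^ 2 + b ^ 2) * (jC a b u.re * jC b a u.im) := by positivity
    linarith
  · by_contra! h
    have : 0 ≤ a * (jD a b u.re * jD b a u.im) := by positivity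
    nlinarith
  · by_contra! h
    have : 0 ≤ (a ^ 2 + b ^ 2) * (jS a b u.re * jC b a u.im * jD a b u.re *
        (jD b a u.im ^ 2 + b ^ 2 * jC a b u.re ^ 2 * jS b a u.im ^ 2)) := by
      have := jD_pos b ha u.re
      positivity
    linarith

/-- Both amplitudes start at π/2 and their sines never vanish, so they stay in (0, π); the signs of
the cosines then select the halves. This removes the lattice ambiguity of the parameter. -/
theorem alphaPrimitive_cell {t : ℝ} (ht : t ∈ Ioo (0 : ℝ) 1) :
    am a b (alphaPrimitive a b t).re ∈ Ioo 0 (Real.pi / 2) ∧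
    am b a (alphaPrimitive a b t).im ∈ Ioo (Real.pi / 2) Real.pi := by
  have hc := (continuousOn_alphaPrimitive ha hb).mono ((Ico_subset_Icc_self : Ico (0 : ℝ) 1 ⊆ _))
  have hφ : ContinuousOn (fun t => am a b (alphaPrimitive a b t).re) (Ico 0 1) :=
    (continuous_am b ha).comp_continuousOn (continuous_re.comp_continuousOn hc)
  have hψ : ContinuousOn (fun t => am b a (alphaPrimitive a b t).im) (Ico 0 1) :=
    (continuous_am a hb).comp_continuousOn (continuous_im.comp_continuousOn hc)
  have hU : alphaPrimitive a b 0 = quarter a b + quarter b a * I := by simp [alphaPrimitive]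
  have hφ0 : am a b (alphaPrimitive a b 0).re = Real.pi / 2 := by
    rw [hU]; simp [quarter, am_ellF b ha]
  have hψ0 : am b a (alphaPrimitive a b 0).im = Real.pi / 2 := by
    rw [hU]; simp [quarter, am_ellF a hb]
  have hpi := Real.pi_pos
  have hS : ∀ t ∈ Ioo (0 : ℝ) 1, Real.sin (am a b (alphaPrimitive a b t).re) ≠ 0 ∧
      Real.sin (am b a (alphaPrimitive a b t).im) ≠ 0 := fun t ht => by
    have := (alphaPrimitive_signs ha hb ht).2.1.ne'
    exact mul_ne_zero_iff.1 this
  have ht' := Ioo_subset_Ico_self ht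
  have q1 : 0 < am a b (alphaPrimitive a b t).re :=
    pos_of_ne_zero hφ (by rw [hφ0]; positivity) (fun t ht h => (hS t ht).1 (by rw [h, Real.sin_zero])) ht'
  have q2 : 0 < Real.pi - am a b (alphaPrimitive a b t).re :=
    pos_of_ne_zero (f := fun t => Real.pi - am a b (alphaPrimitive a b t).re)
      (continuousOn_const.sub hφ) (by rw [hφ0]; linarith) (fun t ht h => (hS t ht).1
      (by rw [← sub_eq_zero.1 h, Real.sin_pi])) ht'
  have q3 : 0 < am b a (alphaPrimitive a b t).im :=
    pos_of_ne_zero hψ (by rw [hψ0]; positivity) (fun t ht h => (hS t ht).2 (by rw [h, Real.sin_zero])) ht'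
  have q4 : 0 < Real.pi - am b a (alphaPrimitive a b t).im :=
    pos_of_ne_zero (f := fun t => Real.pi - am b a (alphaPrimitive a b t).im)
      (continuousOn_const.sub hψ) (by rw [hψ0]; linarith) (fun t ht h => (hS t ht).2
      (by rw [← sub_eq_zero.1 h, Real.sin_pi])) ht'
  have s1 := Real.sin_pos_of_pos_of_lt_pi q1 (by linarith)
  obtain ⟨h1, -, h3⟩ := alphaPrimitive_signs ha hb ht
  simp only [jC, jS] at h1 h3
  have c1 : Real.cos (am b a (alphaPrimitive a b t).im) < 0 := by
    by_contra! h
    nlinarith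
  have c2 : 0 < Real.cos (am a b (alphaPrimitive a b t).re) := by
    by_contra! h
    nlinarith
  refine ⟨⟨q1, ?_⟩, ?_, by linarith⟩
  · by_contra! h
    exact c2.not_ge (Real.cos_nonpos_of_pi_div_two_le_of_le h (by linarith))
  · by_contra! h
    exact c1.not_ge (Real.cos_nonneg_of_neg_pi_div_two_le_of_le (by linarith) h)

/-- The end lies in the closed cell and satisfies Z = a. Since Im Z = 0, one of the sines vanishes;
Re Z = a and the exclusion of a pole then force the cosines 1 and -1, that is, the amplitudes 0 and
π. -/
theorem alphaPrimitive_one : alphaPrimitive a b 1 = 2 * quarter b a * I := by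
  have hsub : 𝓝[<] (1 : ℝ) ≤ 𝓝[Icc 0 1] 1 := by
    rw [← nhdsWithin_Ioo_eq_nhdsLT zero_lt_one]
    exact nhdsWithin_mono _ Ioo_subset_Icc_self
  have tU : Tendsto (alphaPrimitive a b) (𝓝[<] 1) (𝓝 (alphaPrimitive a b 1)) :=
    ((continuousOn_alphaPrimitive ha hb) 1 (by simp)).mono_left hsub
  have hz1 : alphaSeg a b 1 = a := by simp [alphaSeg, corner]
  have tz : Tendsto (alphaSeg a b) (𝓝[<] 1) (𝓝 (a : ℂ)) := by
    rw [← hz1]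
    exact ((continuous_alphaSeg a b).tendsto 1).mono_left nhdsWithin_le_nhds
  have hIoo : Ioo (0 : ℝ) 1 ∈ 𝓝[<] (1 : ℝ) := Ioo_mem_nhdsLT zero_lt_one
  have h0 := alphaPrimitive_spec ha hb (show (0 : ℝ) ∈ Ico 0 1 by simp)
  have hE : elE a b (alphaPrimitive a b 1) ≠ 0 :=
    (isCurvePath_alphaSeg ha hb).elE_ne_zero_of_tendsto ha hb h0.1 h0.2.1 h0.2.2 tz tU
  have hZ : elZ a b (alphaPrimitive a b 1) = a := by
    refine tendsto_nhds_unique_of_eventuallyEq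
      ((hasDerivAt_elZ ha hb hE).continuousAt.tendsto.comp tU) tz ?_
    filter_upwards [hIoo] with t ht
    exact (alphaPrimitive_spec ha hb (Ioo_subset_Ico_self ht)).2.1.symm
  have hφ : am a b (alphaPrimitive a b 1).re ∈ Icc 0 (Real.pi / 2) := by
    refine isClosed_Icc.mem_of_tendsto (((continuous_am b ha).tendsto _).comp
      ((continuous_re.tendsto _).comp tU)) ?_
    filter_upwards [hIoo] with t ht using Ioo_subset_Icc_self (alphaPrimitive_cell ha hb ht).1
  have hψ : am b a (alphaPrimitive a b 1).im ∈ Icc (Real.pi / 2) Real.pi := by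
    refine isClosed_Icc.mem_of_tendsto (((continuous_am a hb).tendsto _).comp
      ((continuous_im.tendsto _).comp tU)) ?_
    filter_upwards [hIoo] with t ht using Ioo_subset_Icc_self (alphaPrimitive_cell ha hb ht).2
  obtain ⟨e1, e2⟩ := elZ_re_im hE
  rw [hZ] at e1 e2
  set u := alphaPrimitive a b 1
  have hpi := Real.pi_pos
  have d1 := jD_pos b ha u.re
  have d2 := jD_pos a hb u.im
  have r1 := jS_sq a b u.re
  have r2 := jD_sq b ha u.re
  have r3 := jS_sq b a u.im
  have r4 := jD_sq a hb u.im
  have hss : jS a b u.re = 0 ∨ jS b a u.im = 0 := by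
    simpa [ha.ne', d1.ne', d2.ne'] using e2.symm
  have hc0 : 0 ≤ jC a b u.re := Real.cos_nonneg_of_neg_pi_div_two_le_of_le (by linarith [hφ.1]) hφ.2
  have hc1 : jC b a u.im ≤ 0 := Real.cos_nonpos_of_pi_div_two_le_of_le hψ.1 (by linarith [hψ.2])
  have e1' : elE a b u = -((a ^ 2 + b ^ 2) * (jC a b u.re * jC b a u.im)) := by
    refine mul_left_cancel₀ ha.ne' ?_
    rw [ofReal_re] at e1
    linear_combination e1
  have hlam : 0 < a ^ 2 + b ^ 2 := by positivity
  have hcc : jC a b u.re = 1 ∧ jC b a u.im = -1 := by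
    rcases hss with h | h
    · have hc : jC a b u.re = 1 := by
        rw [h] at r1
        nlinarith
      refine ⟨hc, ?_⟩
      rw [elE, hc, r4, r3] at e1'
      have : (a ^ 2 + b ^ 2) * (jC b a u.im + 1) = 0 := by linear_combination e1'
      have := (mul_eq_zero.1 this).resolve_left hlam.ne'
      linarith
    · have hc : jC b a u.im = -1 := by
        rw [h] at r3
        nlinarith
      refine ⟨?_, hc⟩
      rw [elE, r4, h, hc] at e1'
      have h1 : (a ^ 2 + b ^ 2) * (jC a b u.re * (jC a b u.re - 1)) = 0 := by
        linear_combination e1'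
      rcases mul_eq_zero.1 ((mul_eq_zero.1 h1).resolve_left hlam.ne') with h2 | h2
      · rw [elE, h2, h] at hE
        simp at hE
      · linarith
  have hφ1 : am a b u.re = 0 :=
    Real.injOn_cos ⟨hφ.1, by linarith [hφ.2]⟩ ⟨le_rfl, hpi.le⟩ (by rw [Real.cos_zero]; exact hcc.1)
  have hψ1 : am b a u.im = Real.pi :=
    Real.injOn_cos ⟨by linarith [hψ.1], hψ.2⟩ ⟨hpi.le, le_rfl⟩ (by rw [Real.cos_pi]; exact hcc.2)
  have x1 := ellF_am b ha u.re
  have x2 := ellF_am a hb u.im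
  rw [hφ1, ellF_zero] at x1
  rw [hψ1, ellF_pi a hb] at x2
  apply Complex.ext
  · simp [← x1]
  · simp [← x2]

theorem integral_alphaIntegrand :
    ∫ t in (0 : ℝ)..1, alphaIntegrand a b t = quarter b a * I - quarter a b := by
  have := alphaPrimitive_one ha hb
  rw [alphaPrimitive] at this
  linear_combination this

/-- The `α`-period. -/
theorem alphaPeriod_eq_quarter : alphaPeriod a b = 2 * (quarter b a * I - quarter a b) := by
  rw [alphaPeriod_eq, integral_alphaIntegrand ha hb]

theorem alphaPeriod_ne_zero : alphaPeriod a b ≠ 0 := by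
  rw [alphaPeriod_eq_quarter ha hb]
  intro h
  have := congrArg re h
  simp [(quarter_pos b ha).ne'] at this

/-- The `β`-period. -/
theorem betaIntegral_one : betaIntegral a b (fun _ => 1) = 2 * (-(quarter b a * I) - quarter a b) := by
  have h : ∫ t in (0 : ℝ)..1, (1 : ℂ) / w a b (corner a b 1 + t * (corner a b 0 - corner a b 1)) *
      (corner a b 0 - corner a b 1) = ∫ t in (0 : ℝ)..1, starRingEnd ℂ (alphaIntegrand a b t) := by
    refine intervalIntegral.integral_congr_Ioo_of_le zero_le_one fun t ht => ?_
    have hw := w_conj ha hb (alphaSeg_re_pos ha ht) (alphaSeg_im_neg hb ht)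
    have hc : corner a b 0 - corner a b 1 = starRingEnd ℂ (corner a b 0 - corner a b 3) := by
      simp [corner, sub_eq_add_neg]
    have hc' : corner a b 1 = starRingEnd ℂ (corner a b 3) := by
      simp [corner]
    have hp : corner a b 1 + t * (corner a b 0 - corner a b 1) = starRingEnd ℂ (alphaSeg a b t) := by
      rw [hc, hc', alphaSeg]
      simp
    simp only [hp, hw, alphaIntegrand, map_mul, map_div₀, map_one]
    rw [hc]
  rw [betaIntegral, cycleIntegral, h, intervalIntegral.intervalIntegral_conj,
    integral_alphaIntegrand ha hb]
  simp

theorem alphaPeriod_mul_B :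
    alphaPeriod a b * B a b = 2 * (-(quarter b a * I) - quarter a b) := by
  rw [B, mul_div_cancel₀ _ (alphaPeriod_ne_zero ha hb), betaIntegral_one ha hb]

/-- The imaginary parts of the two periods cancel in their sum, which is -4 `quarter a b`. -/
theorem alphaPeriod_mul_Kplus : alphaPeriod a b * Kplus a b = -quarter a b := by
  have h1 := alphaPeriod_mul_B ha hb
  have h2 := alphaPeriod_eq_quarter ha hb
  rw [Kplus]
  linear_combination h1 / 4 + h2 / 4

end


/-! ### Explicit lifts over the negative real axis. -/

theorem not_mem_arcs {a b : ℝ} (ha : 0 < a) {z : ℂ} (hz : z.re < 0) :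
    z ∉ alphaArc a b ∪ betaArc a b := by
  have h : ∀ p : ℂ, 0 ≤ p.re → z ∉ segment ℝ p (corner a b 0) := fun p hp hmem => by
    have : z ∈ {z : ℂ | 0 ≤ z.re} :=
      (convex_halfSpace_re_ge 0).segment_subset hp (by simp [corner, ha.le]) hmem
    exact hz.not_ge this
  rintro (hm | hm)
  · exact h _ (by simp [corner]) hm
  · exact h _ (by simp [corner]) hm

theorem tendsto_angle :
    Tendsto (fun t : ℝ => Real.pi / 2 * t) (𝓝[<] 1) (𝓝[<] (Real.pi / 2)) := by
  have hpi : 0 < Real.pi / 2 := by positivity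
  refine tendsto_nhdsWithin_iff.2 ⟨?_, ?_⟩
  · have hθ : Continuous fun t : ℝ => Real.pi / 2 * t := by fun_prop
    have := (hθ.tendsto 1).mono_left (nhdsWithin_le_nhds (s := Iio 1))
    simpa using this
  · filter_upwards [self_mem_nhdsWithin] with t ht
    have : t < 1 := ht
    simp only [mem_Iio]
    nlinarith

/-- A lift from a path parametrized by an angle in `[0, π / 2)`. -/
theorem isLift_of_angle {a b : ℝ} (ha : 0 < a) {p : Surface a b} {u φ : ℂ} {ζ ζ' η μ μ' ω : ℝ → ℂ}
    (hζ : ContinuousOn ζ (Ico 0 (Real.pi / 2))) (hη : ContinuousOn η (Ico 0 (Real.pi / 2)))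
    (hμ : Continuous μ) (hω : ContinuousOn ω (Ico 0 (Real.pi / 2)))
    (h0 : ζ 0 = -(a : ℂ) ∧ η 0 = 0 ∧ μ 0 = 0 ∧ ω 0 = 0)
    (hd : ∀ θ ∈ Ioo 0 (Real.pi / 2),
      η θ ^ 2 = (ζ θ ^ 2 - (a : ℂ) ^ 2) * (ζ θ ^ 2 + (b : ℂ) ^ 2) ∧ η θ ≠ 0 ∧ (ζ θ).re < 0 ∧
      HasDerivAt ζ (ζ' θ) θ ∧ HasDerivAt μ (μ' θ) θ ∧ HasDerivAt ω (ζ θ * μ' θ) θ ∧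
      ζ' θ = μ' θ * η θ)
    (hc : ConvergesTo (fun t => ζ (Real.pi / 2 * t)) (fun t => η (Real.pi / 2 * t)) p)
    (hu : u = (alphaPeriod a b)⁻¹ * μ (Real.pi / 2))
    (hφ : p ≠ .infty 0 → Tendsto (fun θ => exp (ω θ)) (𝓝[<] (Real.pi / 2)) (𝓝 φ)) :
    IsLift p u φ := by
  have hpi : 0 < Real.pi / 2 := by positivity
  have hθ : Continuous fun t : ℝ => Real.pi / 2 * t := by fun_prop
  have hmaps : MapsTo (fun t : ℝ => Real.pi / 2 * t) (Ico 0 1) (Ico 0 (Real.pi / 2)) := fun t ht =>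
    ⟨mul_nonneg hpi.le ht.1, by nlinarith [ht.2]⟩
  have hmaps' : MapsTo (fun t : ℝ => Real.pi / 2 * t) (Ioo 0 1) (Ioo 0 (Real.pi / 2)) := fun t ht =>
    ⟨mul_pos hpi ht.1, by nlinarith [ht.2]⟩
  have hder : ∀ t, HasDerivAt (fun t : ℝ => Real.pi / 2 * t) (Real.pi / 2) t := fun t => by
    simpa using (hasDerivAt_id t).const_mul (Real.pi / 2)
  refine ⟨fun t => ζ (Real.pi / 2 * t), fun t => η (Real.pi / 2 * t),
    fun t => (alphaPeriod a b)⁻¹ * μ (Real.pi / 2 * t), fun t => ω (Real.pi / 2 * t),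
    hζ.comp hθ.continuousOn hmaps, hη.comp hθ.continuousOn hmaps, by fun_prop,
    hω.comp hθ.continuousOn hmaps, by simp [h0.1], by simp [h0.2.1], by simp [h0.2.2.1],
    by simp [h0.2.2.2], fun t ht => ?_, hc, ?_, fun hp => ?_⟩
  · obtain ⟨e1, e2, e3, e4, e5, e6, e7⟩ := hd _ (hmaps' ht)
    have d4 := HasDerivAt.scomp t e4 (hder t)
    have d5 := HasDerivAt.scomp t e5 (hder t)
    have d6 := HasDerivAt.scomp t e6 (hder t)
    have hq : deriv (fun t => ζ (Real.pi / 2 * t)) t / η (Real.pi / 2 * t) =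
        (Real.pi / 2 : ℝ) • μ' (Real.pi / 2 * t) := by
      have := d4.deriv
      rw [show (fun t => ζ (Real.pi / 2 * t)) = ζ ∘ fun t => Real.pi / 2 * t from rfl, this, e7,
        div_eq_iff e2, smul_mul_assoc]
    refine ⟨e1, e2, not_mem_arcs ha e3, d4.differentiableAt, ?_, ?_⟩
    · simp only [hq]
      exact d5.const_mul _
    · rw [mul_div_assoc, hq, mul_smul_comm]
      exact d6
  · rw [hu]
    have h1 : Continuous fun t : ℝ => (alphaPeriod a b)⁻¹ * μ (Real.pi / 2 * t) := by fun_prop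
    have := (h1.tendsto 1).mono_left (nhdsWithin_le_nhds (s := Iio 1))
    simpa using this
  · exact (hφ hp).comp tendsto_angle


section

variable {a b : ℝ} (ha : 0 < a) (hb : 0 < b)

include ha in
-- With z = -a/cos θ, this is an explicit primitive of z dz/w over (-∞, -a], up to the sign of the
-- sheet.
theorem hasDerivAt_arsinh_tan {θ : ℝ} (hθ : 0 < Real.cos θ) :
    HasDerivAt (fun θ => Real.arsinh (a / √(a ^ 2 + b ^ 2) * Real.tan θ))
      (a / (Real.cos θ * √(a ^ 2 + b ^ 2 * Real.cos θ ^ 2))) θ := by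
  have hl : 0 < √(a ^ 2 + b ^ 2) := by positivity
  have hl2 : √(a ^ 2 + b ^ 2) ^ 2 = a ^ 2 + b ^ 2 := Real.sq_sqrt (by positivity)
  have hD := Real.sqrt_pos.2 (radicand_pos b ha (Real.cos θ))
  have hD2 := Real.sq_sqrt (radicand_pos b ha (Real.cos θ)).le
  refine (((Real.hasDerivAt_tan hθ.ne').const_mul (a / √(a ^ 2 + b ^ 2))).arsinh).congr_deriv ?_
  have h : √(1 + (a / √(a ^ 2 + b ^ 2) * Real.tan θ) ^ 2) =
      √(a ^ 2 + b ^ 2 * Real.cos θ ^ 2) / (√(a ^ 2 + b ^ 2) * Real.cos θ) := by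
    rw [← Real.sqrt_sq (show 0 ≤ √(a ^ 2 + b ^ 2 * Real.cos θ ^ 2) /
      (√(a ^ 2 + b ^ 2) * Real.cos θ) by positivity)]
    congr 1
    rw [div_pow, hD2, mul_pow, mul_pow, div_pow, hl2, Real.tan_eq_sin_div_cos]
    field_simp
    rw [Real.sin_sq]
    ring
  rw [h, smul_eq_mul]
  field_simp

include ha hb

/-- The lifts over the segment from `-a` to `-∞`. -/
theorem isLift_infty (k : Fin 2) :
    IsLift (.infty k : Surface a b) ((-1) ^ k.val * Kplus a b) 0 := by
  obtain ⟨σ, hσ, hσ'⟩ : ∃ σ : ℝ, (σ : ℂ) = (-1) ^ k.val ∧ (k = 0 ∨ σ = -1) := by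
    refine ⟨(-1) ^ k.val, by push_cast; rfl, ?_⟩
    fin_cases k <;> simp
  have hσ2 : σ ^ 2 = 1 := by
    have : (σ : ℂ) ^ 2 = 1 := by rw [hσ, ← pow_mul, mul_comm, pow_mul]; simp
    exact_mod_cast this
  have hσ0 : σ ≠ 0 := fun h => by simp [h] at hσ2
  have hpi : 0 < Real.pi / 2 := by positivity
  have hcos : ∀ θ ∈ Ico 0 (Real.pi / 2), 0 < Real.cos θ := fun θ hθ =>
    Real.cos_pos_of_mem_Ioo ⟨by linarith [hθ.1], hθ.2⟩
  have hΔ : ∀ θ, 0 < √(a ^ 2 + b ^ 2 * Real.cos θ ^ 2) := fun θ =>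
    Real.sqrt_pos.2 (radicand_pos b ha _)
  have hα := alphaPeriod_ne_zero ha hb
  -- The path z = -a/cos θ runs from -a to -∞, and σ selects the sheet. For k = 0 the value φ = 0 is
  -- arbitrary, since `IsLift` imposes nothing on φ at `∞⁽⁰⁾`.
  refine isLift_of_angle ha (ζ := fun θ => ((-a / Real.cos θ : ℝ) : ℂ))
    (ζ' := fun θ => ((-a * Real.sin θ / Real.cos θ ^ 2 : ℝ) : ℂ))
    (η := fun θ =>
      ((σ * a * Real.sin θ * √(a ^ 2 + b ^ 2 * Real.cos θ ^ 2) / Real.cos θ ^ 2 : ℝ) : ℂ))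
    (μ := fun θ => ((-σ * ellF a b θ : ℝ) : ℂ))
    (μ' := fun θ => ((-σ * (1 / √(a ^ 2 + b ^ 2 * Real.cos θ ^ 2)) : ℝ) : ℂ))
    (ω := fun θ => ((σ * Real.arsinh (a / √(a ^ 2 + b ^ 2) * Real.tan θ) : ℝ) : ℂ))
    ?_ ?_ ?_ ?_ ?_ ?_ ?_ ?_ ?_
  · exact continuous_ofReal.comp_continuousOn (continuousOn_const.div
      Real.continuous_cos.continuousOn fun θ hθ => (hcos θ hθ).ne')
  · refine continuous_ofReal.comp_continuousOn (ContinuousOn.div (by fun_prop) (by fun_prop)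
      fun θ hθ => pow_ne_zero 2 (hcos θ hθ).ne')
  · have := continuous_ellF b ha
    fun_prop
  · intro θ hθ
    exact ((hasDerivAt_arsinh_tan (b := b) ha (hcos θ hθ)).const_mul σ).ofReal_comp.continuousAt.continuousWithinAt
  · simp [ellF_zero]
  · intro θ hθ
    have hc := hcos θ (Ioo_subset_Ico_self hθ)
    have hs : 0 < Real.sin θ := Real.sin_pos_of_pos_of_lt_pi hθ.1 (by linarith [hθ.2])
    have hΔ2 := Real.sq_sqrt (radicand_pos b ha (Real.cos θ)).le
    have hd := hΔ θ
    refine ⟨?_, ?_, ?_, ?_, ?_, ?_, ?_⟩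
    · norm_cast
      rw [div_pow, mul_pow, mul_pow, mul_pow, hσ2, hΔ2]
      field_simp
      rw [Real.sin_sq]
    · rw [ofReal_ne_zero]
      positivity
    · rw [ofReal_re]
      exact div_neg_of_neg_of_pos (by linarith) hc
    · refine HasDerivAt.ofReal_comp (HasDerivAt.congr_deriv
        ((hasDerivAt_const θ (-a)).div (Real.hasDerivAt_cos θ) hc.ne') ?_)
      ring
    · exact ((hasDerivAt_ellF b ha θ).const_mul (-σ)).ofReal_comp
    · rw [← ofReal_mul]
      refine (((hasDerivAt_arsinh_tan (b := b) ha hc).const_mul σ).congr_deriv ?_).ofReal_comp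
      field_simp
    · norm_cast
      field_simp
      rw [hσ2]
  · refine ⟨?_, ?_⟩
    · rw [← tendsto_norm_atTop_iff_cobounded]
      have h := ((Real.tendsto_cos_pi_div_two.comp tendsto_angle).inv_tendsto_nhdsGT_zero).const_mul_atTop ha
      refine h.congr' ?_
      filter_upwards [tendsto_angle.eventually (Ioo_mem_nhdsLT hpi)] with t ht
      have := hcos _ (Ioo_subset_Ico_self ht)
      rw [norm_real, Real.norm_eq_abs, abs_div, abs_neg, abs_of_pos ha, abs_of_pos this,
        div_eq_mul_inv]
      rfl
    · have hc : Continuous fun t : ℝ => ((σ * Real.sin (Real.pi / 2 * t) *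
          √(a ^ 2 + b ^ 2 * Real.cos (Real.pi / 2 * t) ^ 2) / a : ℝ) : ℂ) := by fun_prop
      have := (hc.tendsto 1).mono_left (nhdsWithin_le_nhds (s := Iio 1))
      rw [mul_one, Real.sin_pi_div_two, Real.cos_pi_div_two, zero_pow two_ne_zero, mul_zero,
        add_zero, Real.sqrt_sq ha.le, mul_one, mul_div_cancel_right₀ _ ha.ne', hσ] at this
      refine this.congr' ?_
      filter_upwards [tendsto_angle.eventually (Ioo_mem_nhdsLT hpi)] with t ht
      have := (hcos _ (Ioo_subset_Ico_self ht)).ne'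
      norm_cast
      generalize Real.pi / 2 * t = θ at *
      field_simp
  · have h := alphaPeriod_mul_Kplus ha hb
    rw [eq_inv_mul_iff_mul_eq₀ hα, ← hσ]
    have : ellF a b (Real.pi / 2) = quarter a b := rfl
    rw [this]
    push_cast
    linear_combination σ * h
  · intro hk
    have hσ1 : σ = -1 := hσ'.resolve_left fun h => hk (by rw [h])
    rw [tendsto_zero_iff_norm_tendsto_zero]
    simp only [norm_exp, ofReal_re, hσ1, neg_one_mul]
    have hl : 0 < a / √(a ^ 2 + b ^ 2) := by positivity
    have h1 := Real.tendsto_tan_pi_div_two.const_mul_atTop hl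
    refine tendsto_of_tendsto_of_tendsto_of_le_of_le' tendsto_const_nhds h1.inv_tendsto_atTop
      (Eventually.of_forall fun _ => (Real.exp_pos _).le) ?_
    filter_upwards [h1.eventually_gt_atTop 0] with θ hθ
    rw [Real.exp_neg, Real.exp_arsinh, Pi.inv_apply]
    exact inv_anti₀ hθ (le_add_of_nonneg_right (Real.sqrt_nonneg _))

/-- The lift over the segment from `-a` to `0`. -/
theorem exists_isLift_zeroPt : ∃ φ u, IsLift (zeroPt a b) u φ := by
  have hpi : 0 < Real.pi / 2 := by positivity
  have hΔ : ∀ θ, 0 < √(b ^ 2 + a ^ 2 * Real.cos θ ^ 2) := fun θ =>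
    Real.sqrt_pos.2 (radicand_pos a hb _)
  have hcω : Continuous fun θ => a * Real.cos θ / √(b ^ 2 + a ^ 2 * Real.cos θ ^ 2) :=
    Continuous.div (by fun_prop) (by fun_prop) fun θ => (hΔ θ).ne'
  have hω : ∀ θ, HasDerivAt
      (fun θ => I * (∫ s in (0 : ℝ)..θ, a * Real.cos s / √(b ^ 2 + a ^ 2 * Real.cos s ^ 2) : ℝ))
      (I * ((a * Real.cos θ / √(b ^ 2 + a ^ 2 * Real.cos θ ^ 2) : ℝ) : ℂ)) θ := fun θ =>
    (hcω.integral_hasStrictDerivAt 0 θ).hasDerivAt.ofReal_comp.const_mul I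
  have hωc : Continuous
      (fun θ => I * (∫ s in (0 : ℝ)..θ, a * Real.cos s / √(b ^ 2 + a ^ 2 * Real.cos s ^ 2) : ℝ)) :=
    continuous_iff_continuousAt.2 fun θ => (hω θ).continuousAt
  -- The path z = -a cos θ runs from -a to 0, and y ends at iab. The value of Φ may stay an
  -- exponential of an integral, because only its square is used.
  refine ⟨_, _, isLift_of_angle ha (ζ := fun θ => ((-a * Real.cos θ : ℝ) : ℂ))
    (ζ' := fun θ => ((a * Real.sin θ : ℝ) : ℂ))
    (η := fun θ => I * ((a * Real.sin θ * √(b ^ 2 + a ^ 2 * Real.cos θ ^ 2) : ℝ) : ℂ))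
    (μ := fun θ => -I * (ellF b a θ : ℂ))
    (μ' := fun θ => -I * ((1 / √(b ^ 2 + a ^ 2 * Real.cos θ ^ 2) : ℝ) : ℂ))
    (ω := fun θ => I * (∫ s in (0 : ℝ)..θ, a * Real.cos s / √(b ^ 2 + a ^ 2 * Real.cos s ^ 2) : ℝ))
    ?_ ?_ ?_ hωc.continuousOn ?_ ?_ ?_ rfl
    fun _ => (hωc.cexp.tendsto (Real.pi / 2)).mono_left nhdsWithin_le_nhds⟩
  · fun_prop
  · fun_prop
  · have := continuous_ellF a hb
    fun_prop
  · simp [ellF_zero]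
  · intro θ hθ
    have hc : 0 < Real.cos θ := Real.cos_pos_of_mem_Ioo ⟨by linarith [hθ.1], hθ.2⟩
    have hs : 0 < Real.sin θ := Real.sin_pos_of_pos_of_lt_pi hθ.1 (by linarith [hθ.2])
    have hΔ2 := Real.sq_sqrt (radicand_pos a hb (Real.cos θ)).le
    have hd := hΔ θ
    refine ⟨?_, ?_, ?_, ?_, ?_, ?_, ?_⟩
    · rw [mul_pow, I_sq]
      norm_cast
      rw [mul_pow, mul_pow, hΔ2, Real.sin_sq]
      push_cast
      ring
    · refine mul_ne_zero I_ne_zero (ofReal_ne_zero.2 ?_)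
      positivity
    · rw [ofReal_re]
      nlinarith
    · refine HasDerivAt.ofReal_comp (HasDerivAt.congr_deriv
        ((Real.hasDerivAt_cos θ).const_mul (-a)) ?_)
      ring
    · exact (hasDerivAt_ellF a hb θ).ofReal_comp.const_mul (-I)
    · refine (hω θ).congr_deriv ?_
      push_cast
      ring
    · have : (√(b ^ 2 + a ^ 2 * Real.cos θ ^ 2) : ℂ) ≠ 0 := ofReal_ne_zero.2 hd.ne'
      push_cast
      field_simp
      simp
  · refine ⟨?_, ?_⟩
    · have h : Continuous fun t : ℝ => ((-a * Real.cos (Real.pi / 2 * t) : ℝ) : ℂ) := by fun_prop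
      have := (h.tendsto 1).mono_left (nhdsWithin_le_nhds (s := Iio 1))
      simpa using this
    · have h : Continuous fun t : ℝ => I * ((a * Real.sin (Real.pi / 2 * t) *
        √(b ^ 2 + a ^ 2 * Real.cos (Real.pi / 2 * t) ^ 2) : ℝ) : ℂ) := by fun_prop
      have := (h.tendsto 1).mono_left (nhdsWithin_le_nhds (s := Iio 1))
      simpa [Real.sqrt_sq hb.le, mul_assoc] using this

end


/-! ### The points at infinity in the Jacobi variety. -/

section

variable {a b : ℝ} (ha : 0 < a) (hb : 0 < b)

include ha hb

/-- Modulo periods, the poles with m + n odd are -P and those with m + n even are P, where P =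
`quarter a b`; and K₊ times the α-period is -P. -/
theorem jacEq_of_isLift_infty {u φ : ℂ} {k : Fin 2} (h : IsLift (.infty k : Surface a b) u φ) :
    JacEq a b u ((-1) ^ k.val * Kplus a b) := by
  have hα := alphaPeriod_ne_zero ha hb
  obtain ⟨m, n, hu, hk⟩ := h.infty ha hb hα
  have h1 := alphaPeriod_eq_quarter ha hb
  have h2 := alphaPeriod_mul_B ha hb
  have h3 := alphaPeriod_mul_Kplus ha hb
  fin_cases k
  · have hodd : Odd (m + n) := by
      by_contra hne
      rw [Int.not_odd_iff_even] at hne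
      rw [hne.neg_one_zpow] at hk
      norm_num at hk
    obtain ⟨r, hr⟩ := hodd
    have hn : (n : ℂ) = 2 * r + 1 - m := by
      have : n = 2 * r + 1 - m := by omega
      rw [this]; push_cast; ring
    refine ⟨r - m, -r - 1, mul_left_cancel₀ hα ?_⟩
    rw [hu, hn]
    push_cast
    linear_combination -h3 - (r - m : ℂ) * h1 + (r + 1 : ℂ) * h2
  · have heven : Even (m + n) := by
      by_contra hne
      rw [Int.not_even_iff_odd] at hne
      rw [hne.neg_one_zpow] at hk
      norm_num at hk
    obtain ⟨r, hr⟩ := heven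
    have hn : (n : ℂ) = 2 * r - m := by
      have : n = 2 * r - m := by omega
      rw [this]; push_cast; ring
    refine ⟨r - m, -r, mul_left_cancel₀ hα ?_⟩
    rw [hu, hn]
    push_cast
    linear_combination h3 - (r - m : ℂ) * h1 + (r : ℂ) * h2

/-- This keeps the classes of the two points at infinity apart: real and imaginary parts would give
l + m = 1 and l = m. -/
theorem not_jacEq_two_Kplus (l m : ℤ) : 2 * Kplus a b ≠ l + B a b * m := by
  intro h
  have h1 := alphaPeriod_eq_quarter ha hb
  have h2 := alphaPeriod_mul_B ha hb
  have h3 := alphaPeriod_mul_Kplus ha hb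
  have e : -2 * (quarter a b : ℂ) = l * (2 * (quarter b a * I - quarter a b)) +
      m * (2 * (-(quarter b a * I) - quarter a b)) := by
    linear_combination alphaPeriod a b * h + l * h1 + m * h2 - 2 * h3
  have hP := quarter_pos b ha
  have hQ := quarter_pos a hb
  have ere := congrArg re e
  have eim := congrArg im e
  simp at ere eim
  have e1 : (l : ℝ) + m = 1 := by
    refine mul_right_cancel₀ hP.ne' ?_
    linarith
  have e2 : (l : ℝ) - m = 0 := by
    refine mul_right_cancel₀ hQ.ne' ?_
    linarith
  norm_cast at e1 e2
  omega

/-- An integral of this class is a pole of `elZ`, which no finite endpoint allows, and the other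
point at infinity has a different class. So the point does not depend on the choice made in
`thetaZero`. -/
theorem eq_infty_of_jacEq {p : Surface a b} {u φ : ℂ} {k : Fin 2} (h : IsLift p u φ)
    (hu : JacEq a b u ((-1) ^ k.val * Kplus a b)) : p = .infty k := by
  have hα := alphaPeriod_ne_zero ha hb
  have h1 := alphaPeriod_eq_quarter ha hb
  have h2 := alphaPeriod_mul_B ha hb
  have h3 := alphaPeriod_mul_Kplus ha hb
  cases p with
  | affine z y hp =>
    exfalso
    obtain ⟨l, m, hu⟩ := hu
    refine (h.affine ha hb hα).1 ?_
    fin_cases k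
    · rw [← elE_pole ha hb (-l - m - 1) (l - m), hu]
      congr 1
      push_cast
      linear_combination h3 + l * h1 + m * h2
    · rw [← elE_pole ha hb (-l - m) (l - m), hu]
      congr 1
      push_cast
      linear_combination -h3 + l * h1 + m * h2
  | infty j =>
    by_contra hne
    have hj := jacEq_of_isLift_infty ha hb h
    obtain ⟨l, m, hu⟩ := hu
    obtain ⟨l', m', hj⟩ := hj
    fin_cases k <;> fin_cases j <;> simp at hne hu hj
    · refine not_jacEq_two_Kplus ha hb (l' - l) (m' - m) ?_
      push_cast
      linear_combination hj - hu
    · refine not_jacEq_two_Kplus ha hb (l - l') (m - m') ?_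
      push_cast
      linear_combination hu - hj

omit ha hb in
theorem thetaZero_spec {c : ℂ} {k : ℕ} (h : ∃ d : ThetaZero a b, d.Spec c k) :
    (thetaZero a b c k).Spec c k := by
  rw [thetaZero, dif_pos h]
  exact h.choose_spec

theorem thetaZero_of_jacEq {c : ℂ} {k : ℕ} {j : Fin 2}
    (h : JacEq a b c ((-1) ^ k * Kplus a b + (-1) ^ j.val * Kplus a b)) :
    (thetaZero a b c k).pt = .infty j ∧ (j = 1 → (thetaZero a b c k).phi = 0) := by
  obtain ⟨l, m, hc⟩ := h
  have hs : (thetaZero a b c k).Spec c k := by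
    -- The explicit lift over (-∞, -a] shows that `thetaZero` is not the default; its integers
    -- cancel the period contained in c.
    refine thetaZero_spec ⟨⟨.infty j, 0, -l, -m⟩, ?_⟩
    have h := isLift_infty ha hb j
    unfold ThetaZero.Spec
    convert h using 1
    rw [hc]
    push_cast
    ring
  unfold ThetaZero.Spec at hs
  generalize thetaZero a b c k = d at *
  have hp : d.pt = .infty j := by
    refine eq_infty_of_jacEq ha hb hs ⟨l + d.l, m + d.m, ?_⟩
    rw [hc]
    push_cast
    ring
  refine ⟨hp, fun hj => ?_⟩
  rw [hp, hj] at hs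
  exact hs.infty_one ha hb (alphaPeriod_ne_zero ha hb)

theorem jacEq_of_thetaZero {c : ℂ} {k : ℕ} (h : (thetaZero a b c k).pt = .infty 0) :
    JacEq a b c ((-1) ^ k * Kplus a b + Kplus a b) := by
  have hs : (thetaZero a b c k).Spec c k := by
    -- Without a solution `thetaZero` would be the default, a finite ramification point, contrary to
    -- `h`.
    refine thetaZero_spec (by_contra fun hne => ?_)
    rw [thetaZero, dif_neg hne] at h
    simp [ramification3] at h
  unfold ThetaZero.Spec at hs
  generalize thetaZero a b c k = d at *
  rw [h] at hs
  obtain ⟨l, m, hu⟩ := jacEq_of_isLift_infty ha hb hs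
  simp at hu
  refine ⟨l - d.l, m - d.m, ?_⟩
  push_cast
  linear_combination hu

/-! ### The size and the rotation of A. -/

/-- `Φ(𝟎)²` for the point `𝟎`. -/
theorem Phi_zeroPt_sq :
    (a ^ 2 + b ^ 2) * Phi (zeroPt a b) ^ 2 = b ^ 2 - a ^ 2 + 2 * (I * a * b) := by
  have h := exists_isLift_zeroPt ha hb
  obtain ⟨u, hu⟩ := h.choose_spec
  rw [Phi, dif_pos h]
  generalize h.choose = φ at *
  have := (IsLift.affine ha hb (alphaPeriod_ne_zero ha hb) hu).2
  rw [this]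
  ring

omit ha hb in
-- The right side is (b ± ia)², of modulus a² + b².
theorem norm_eq_one_of_sq {φ : ℂ} (ha : 0 < a) (hb : 0 < b) {y : ℂ} (hy : y = I * a * b ∨ y = -(I * a * b))
    (h : (a ^ 2 + b ^ 2) * φ ^ 2 = 2 * 0 ^ 2 + b ^ 2 - a ^ 2 + 2 * y) : ‖φ‖ = 1 := by
  have hl : 0 < a ^ 2 + b ^ 2 := by positivity
  have hn : normSq (2 * 0 ^ 2 + b ^ 2 - a ^ 2 + 2 * y) = (a ^ 2 + b ^ 2) ^ 2 := by
    rcases hy with rfl | rfl <;>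
    · rw [normSq_apply]
      simp [← ofReal_pow]
      ring
  have h2 : normSq (((a ^ 2 + b ^ 2 : ℝ) : ℂ) * φ ^ 2) = (a ^ 2 + b ^ 2) ^ 2 := by
    rw [← hn, ← h]
    push_cast
    rfl
  rw [normSq_mul, normSq_ofReal, map_pow, normSq_eq_norm_sq, ← pow_mul, ← sq] at h2
  have h4 : ‖φ‖ ^ 4 = 1 := mul_left_cancel₀ (pow_pos hl 2).ne' (by rw [h2, mul_one])
  exact (pow_eq_one_iff_of_nonneg (norm_nonneg _) (by norm_num)).1 h4

theorem norm_Phi_originPt (ν : ℂ) : ‖Phi (originPt a b ν)‖ = 1 := by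
  have hα := alphaPeriod_ne_zero ha hb
  rw [Phi]
  split_ifs with h
  · obtain ⟨u, hu⟩ := h.choose_spec
    generalize h.choose = φ at *
    rw [originPt] at hu
    split_ifs at hu
    · exact norm_eq_one_of_sq ha hb (Or.inl rfl) (IsLift.affine ha hb hα hu).2
    · exact norm_eq_one_of_sq ha hb (Or.inr rfl) (IsLift.affine ha hb hα hu).2
  -- Without a lift the default value 1 also has modulus 1, so no lift to `𝟎*` has to be
  -- constructed.
  · simp

omit ha hb in
theorem A_eq_zero {ρ lg : Fin 4 → ℂ → ℂ} {n : ℕ}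
    (h : (thetaZero a b (crho a b lg) (n % 2)).phi = 0) : A a b ρ lg n = 0 := by
  rw [A]
  split_ifs
  · rfl
  · simp [h]

omit ha hb in
/-- The dependence of `A_{ρ,n}` on `n`. -/
theorem exists_A_eq (ρ lg : Fin 4 → ℂ → ℂ) (h : (nu lg).re ≠ 0) :
    ∃ C : ℕ → ℂ, ∀ n, A a b ρ lg n = C (n % 2) *
      (((a * b / (2 * n) : ℝ) : ℂ) ^ (1 / 2 - varsigma (nu lg) * nu lg)) *
      Phi (originPt a b (nu lg)) ^ (2 * (n - 1)) := by
  refine ⟨fun k => (-1) ^ ((thetaZero a b (crho a b lg) k).l + (thetaZero a b (crho a b lg) k).m +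
    (k : ℤ)) * (Aconst a b ρ (nu lg) *
    exp (Real.pi * I * varsigma (nu lg) * (crho a b lg + 1 / 4)) *
    ((Real.sqrt (a ^ 2 + b ^ 2) : ℂ) / 2) *
    (Complex.Gamma (1 - varsigma (nu lg) * nu lg) / (Real.sqrt (2 * Real.pi) : ℂ)) *
    szegoLimit a b lg ^ varsigma (nu lg)) * (thetaZero a b (crho a b lg) k).phi, fun n => ?_⟩
  rw [A, if_neg h, Aprime]
  ring

/-- As |Φ(𝐨)| = 1 and the constants depend only on the parity of n, the decay comes from the power
of 1/n alone, whose exponent has real part 1/2 - |Re ν| > 0. -/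
theorem tendsto_A (ρ lg : Fin 4 → ℂ → ℂ) (h0 : (nu lg).re ≠ 0) (h : |(nu lg).re| < 1 / 2) :
    Tendsto (A a b ρ lg) atTop (𝓝 0) := by
  obtain ⟨C, hC⟩ := exists_A_eq (a := a) (b := b) ρ lg h0
  obtain ⟨s, hs, hs0⟩ : ∃ s : ℂ, s = 1 / 2 - varsigma (nu lg) * nu lg ∧ 0 < s.re := by
    refine ⟨_, rfl, ?_⟩
    rw [abs_lt] at h
    rw [varsigma]
    split_ifs with hpos
    · simp; linarith
    · simp; linarith
  rw [← hs] at hC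
  have hx : Tendsto (fun n : ℕ => a * b / (2 * n) : ℕ → ℝ) atTop (𝓝 0) :=
    (tendsto_const_nhds (x := a * b)).div_atTop
      (tendsto_natCast_atTop_atTop.const_mul_atTop two_pos)
  have hxs := hx.rpow_const (p := s.re) (Or.inr hs0.le)
  rw [Real.zero_rpow hs0.ne'] at hxs
  have hb' := hxs.const_mul (max ‖C 0‖ ‖C 1‖)
  rw [mul_zero] at hb'
  refine squeeze_zero_norm' ?_ hb'
  filter_upwards [eventually_ge_atTop 1] with n hn
  have hn' : (0 : ℝ) < n := by exact_mod_cast hn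
  rw [hC, norm_mul, norm_mul, norm_pow, norm_Phi_originPt ha hb, one_pow, mul_one,
    norm_cpow_eq_rpow_re_of_pos (by positivity)]
  gcongr
  rcases Nat.mod_two_eq_zero_or_one n with h | h <;> rw [h]
  · exact le_max_left _ _
  · exact le_max_right _ _

/-- The ratio of the numbers `A_{ρ,n}` for indices of the same parity. -/
theorem A_add (ρ lg : Fin 4 → ℂ → ℂ) (h : (nu lg).re = 1 / 2) (j : ℕ) {n : ℕ} (hn : 1 ≤ n) :
    A a b ρ lg (n + 2 * j) = A a b ρ lg n *
      (((n / (n + 2 * j) : ℝ) : ℂ) ^ (1 / 2 - nu lg) * (Phi (zeroPt a b) ^ 4) ^ j) := by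
  have h0 : 0 < (nu lg).re := by rw [h]; norm_num
  obtain ⟨C, hC⟩ := exists_A_eq (a := a) (b := b) ρ lg h0.ne'
  have hn' : (0 : ℝ) < n := by exact_mod_cast hn
  have hv : varsigma (nu lg) = 1 := by rw [varsigma, if_pos h0]
  have ho : originPt a b (nu lg) = zeroPt a b := by rw [originPt, if_pos h0]
  rw [hC, hC, hv, ho, Nat.add_mul_mod_self_left, Int.cast_one, one_mul,
    show 2 * (n + 2 * j - 1) = 2 * (n - 1) + 4 * j by omega, pow_add, pow_mul _ 4 j]
  have hx : (((a * b / (2 * (n + 2 * j : ℕ)) : ℝ)) : ℂ) =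
      ((a * b / (2 * n) : ℝ) : ℂ) * ((n / (n + 2 * j) : ℝ) : ℂ) := by
    rw [← ofReal_mul]
    congr 1
    push_cast
    field_simp
  rw [hx, mul_cpow_ofReal_nonneg (by positivity) (by positivity)]
  ring

omit ha hb in
theorem norm_ratio_cpow {s : ℂ} (hs : s.re = 0) (j : ℕ) {n : ℕ} (hn : 1 ≤ n) :
    ‖((n / (n + 2 * j) : ℝ) : ℂ) ^ s‖ = 1 := by
  have hn' : (0 : ℝ) < n := by exact_mod_cast hn
  rw [norm_cpow_eq_rpow_re_of_pos (by positivity), hs, Real.rpow_zero]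

omit ha hb in
theorem tendsto_ratio_cpow (s : ℂ) (j : ℕ) :
    Tendsto (fun n : ℕ => ((n / (n + 2 * j) : ℝ) : ℂ) ^ s) atTop (𝓝 1) := by
  have h1 : Tendsto (fun n : ℕ => (n / (n + 2 * j) : ℝ)) atTop (𝓝 1) := by
    simpa using tendsto_natCast_div_add_atTop (𝕜 := ℝ) (2 * j : ℝ)
  have h2 := (continuous_ofReal.tendsto (1 : ℝ)).comp h1
  rw [ofReal_one] at h2
  have h3 : ContinuousAt (fun x : ℂ => x ^ s) 1 :=
    continuousAt_id.cpow continuousAt_const one_mem_slitPlane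
  have := h3.tendsto.comp h2
  rwa [one_cpow] at this

/-- The number x = Φ(𝟎)² is unimodular with imaginary part 2ab/(a² + b²), and |x² - 1| = |x - x̄| =
2|Im x|. -/
theorem norm_Phi_pow_sub_one : ‖Phi (zeroPt a b) ^ 4 - 1‖ = 2 * (2 * a * b / (a ^ 2 + b ^ 2)) := by
  have h := Phi_zeroPt_sq ha hb
  have hl : 0 < a ^ 2 + b ^ 2 := by positivity
  have hl' : (a : ℂ) ^ 2 + b ^ 2 ≠ 0 := by exact_mod_cast hl.ne'
  have e : (((a ^ 2 + b ^ 2 : ℝ) : ℂ)) * (Phi (zeroPt a b) ^ 4 - 1) =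
      4 * a * b * I * Phi (zeroPt a b) ^ 2 := by
    refine mul_left_cancel₀ hl' ?_
    push_cast
    linear_combination ((a ^ 2 + b ^ 2) * Phi (zeroPt a b) ^ 2 + (b ^ 2 - a ^ 2 + 2 * (I * a * b)) -
      4 * a * b * I) * h + (-4 * a ^ 2 * b ^ 2) * I_sq
  have hP : ‖Phi (zeroPt a b)‖ = 1 := by
    have := norm_Phi_originPt ha hb 1
    rwa [originPt, if_pos (by simp)] at this
  have e' := congrArg norm e
  simp only [norm_mul, norm_pow, hP, norm_I, norm_real, Real.norm_eq_abs, abs_of_pos hl,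
    abs_of_pos ha, abs_of_pos hb] at e'
  norm_num at e'
  field_simp
  linarith

end

/-! ### Rotations of the unit circle and the admissible indices. -/

/-- The powers of a number `v ≠ 1` on the unit circle do not stay close to `1`. -/
theorem exists_one_le_norm_pow_sub_one {v : ℂ} (hv : ‖v‖ = 1) (hv1 : v ≠ 1) :
    ∃ j : ℕ, 1 ≤ ‖v ^ j - 1‖ := by
  by_contra! h
  have hstep : ∀ k : ℕ, (3 / 2) ^ k * ‖v - 1‖ ≤ ‖v ^ 2 ^ k - 1‖ := by
    intro k
    induction k with
    | zero => simp
    | succ k ih =>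
      have hn : ‖v ^ 2 ^ k‖ = 1 := by rw [norm_pow, hv, one_pow]
      have hlt := h (2 ^ k)
      rw [pow_succ 2 k, pow_mul]
      generalize v ^ 2 ^ k = x at *
      -- Since |x + 1|² = 4 - |x - 1|² > 3, each squaring multiplies the distance to 1 by at least
      -- 3/2, which cannot continue below distance 1.
      have hpar := parallelogram_law_with_norm ℝ x 1
      rw [hn, norm_one] at hpar
      have h32 : 3 / 2 ≤ ‖x + 1‖ := by
        nlinarith [norm_nonneg (x + 1), norm_nonneg (x - 1)]
      rw [show x ^ 2 - 1 = (x + 1) * (x - 1) by ring, norm_mul, pow_succ]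
      calc (3 / 2 : ℝ) ^ k * (3 / 2) * ‖v - 1‖ = 3 / 2 * ((3 / 2) ^ k * ‖v - 1‖) := by ring
        _ ≤ ‖x + 1‖ * ‖x - 1‖ := by gcongr
  have hpos : 0 < ‖v - 1‖ := norm_pos_iff.2 (sub_ne_zero.2 hv1)
  obtain ⟨k, hk⟩ := pow_unbounded_of_one_lt (1 / ‖v - 1‖) (show (1 : ℝ) < 3 / 2 by norm_num)
  rw [div_lt_iff₀ hpos] at hk
  exact absurd (hk.le.trans (hstep k)) (h _).not_ge

/-- If `x` and `x r` are close to `1`, then so is `r`. -/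
theorem norm_sub_one_lt {x r : ℂ} {ε : ℝ} (hr : ‖r‖ = 1) (h1 : ‖1 - x‖ < ε) (h2 : ‖1 - x * r‖ < ε) :
    ‖r - 1‖ < 2 * ε := by
  have e : r - 1 = r * (1 - x) - (1 - x * r) := by ring
  calc ‖r - 1‖ ≤ ‖r * (1 - x)‖ + ‖1 - x * r‖ := by rw [e]; exact norm_sub_le _ _
    _ < 2 * ε := by rw [norm_mul, hr]; linarith

section

variable {a b ε : ℝ} (ha : 0 < a) (hb : 0 < b) {ρ lg : Fin 4 → ℂ → ℂ}

include ha hb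

omit ha hb in
theorem mem_admissible_of_A_eq_zero (hε : ε < 1 / 2) {n : ℕ} (hn : 1 ≤ n)
    (hpt : (thetaZero a b (crho a b lg) (n % 2)).pt ≠ .infty 0) (hA : A a b ρ lg n = 0) :
    n ∈ admissible a b ρ lg ε := by
  refine ⟨hn, hpt, ?_⟩
  rw [hA, sub_zero, norm_one]
  linarith

/-- Even n lead to `∞⁽¹⁾`, where Φ and hence A vanish; odd n lead to the forbidden point `∞⁽⁰⁾`. -/
theorem admissible_of_jacEq_zero (hε : ε < 1 / 2) (h : JacEq a b (crho a b lg) 0) :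
    admissible a b ρ lg ε = {n : ℕ | 1 ≤ n ∧ Even n} := by
  ext n
  rcases Nat.even_or_odd n with hn | hn
  · have h' := thetaZero_of_jacEq ha hb (c := crho a b lg) (k := n % 2) (j := 1)
      (by rw [Nat.even_iff.1 hn]; simpa using h)
    refine ⟨fun hm => ⟨hm.1, hn⟩, fun hm => mem_admissible_of_A_eq_zero hε hm.1 ?_
      (A_eq_zero (h'.2 rfl))⟩
    rw [h'.1]; simp
  · have h' := thetaZero_of_jacEq ha hb (c := crho a b lg) (k := n % 2) (j := 0)
      (by rw [Nat.odd_iff.1 hn]; simpa using h)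
    exact ⟨fun hm => absurd h'.1 hm.2.1, fun hm => absurd hm.2 (Nat.not_even_iff_odd.2 hn)⟩

theorem admissible_of_jacEq_half (hε : ε < 1 / 2) (h : JacEq a b (crho a b lg) ((1 + B a b) / 2)) :
    admissible a b ρ lg ε = {n : ℕ | Odd n} := by
  ext n
  obtain ⟨l, m, hc⟩ := h
  rcases Nat.even_or_odd n with hn | hn
  · have h' := thetaZero_of_jacEq ha hb (c := crho a b lg) (k := n % 2) (j := 0)
      (by
        rw [Nat.even_iff.1 hn]
        refine ⟨l, m, ?_⟩
        rw [hc, Kplus]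
        simp
        ring)
    exact ⟨fun hm => absurd h'.1 hm.2.1, fun hm => absurd hn (Nat.not_even_iff_odd.2 hm)⟩
  · have h' := thetaZero_of_jacEq ha hb (c := crho a b lg) (k := n % 2) (j := 1)
      (by
        rw [Nat.odd_iff.1 hn]
        -- For odd n the class required at `∞⁽¹⁾` is that of -(1 + B)/2, which differs from (1 +
        -- B)/2 by the period 1 + B.
        refine ⟨l + 1, m + 1, ?_⟩
        rw [hc, Kplus]
        push_cast
        simp
        ring)
    refine ⟨fun _ => hn, fun _ => mem_admissible_of_A_eq_zero hε hn.pos ?_ (A_eq_zero (h'.2 rfl))⟩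
    rw [h'.1]; simp

theorem thetaZero_pt_ne (h0 : ¬ JacEq a b (crho a b lg) 0)
    (h1 : ¬ JacEq a b (crho a b lg) ((1 + B a b) / 2)) (n : ℕ) :
    (thetaZero a b (crho a b lg) (n % 2)).pt ≠ .infty 0 := by
  intro h
  have hj := jacEq_of_thetaZero ha hb h
  rcases Nat.mod_two_eq_zero_or_one n with hn | hn
  · refine h1 ?_
    rw [hn] at hj
    convert hj using 1
    rw [Kplus]
    ring
  · refine h0 ?_
    rw [hn] at hj
    convert hj using 1
    ring

variable (h0 : ¬ JacEq a b (crho a b lg) 0) (h1 : ¬ JacEq a b (crho a b lg) ((1 + B a b) / 2))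

include h0 h1

theorem admissible_of_re_nu_eq_zero (hε : ε < 1 / 2) (hν : (nu lg).re = 0) :
    admissible a b ρ lg ε = {n : ℕ | 1 ≤ n} := by
  ext n
  refine ⟨fun hn => hn.1, fun hn => mem_admissible_of_A_eq_zero hε hn
    (thetaZero_pt_ne ha hb h0 h1 n) ?_⟩
  rw [A, if_pos hν]

theorem eventually_mem_admissible (hε : ε < 1 / 2) (hν : |(nu lg).re| < 1 / 2) :
    ∃ n₀ : ℕ, ∀ n ≥ n₀, n ∈ admissible a b ρ lg ε := by
  by_cases hz : (nu lg).re = 0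
  · refine ⟨1, fun n hn => ?_⟩
    rw [admissible_of_re_nu_eq_zero ha hb h0 h1 hε hz]
    exact hn
  · have hA := (tendsto_A ha hb ρ lg hz hν).const_sub 1
    have hn := hA.norm
    rw [sub_zero, norm_one] at hn
    obtain ⟨N, hN⟩ := eventually_atTop.1 (hn.eventually_const_le (show ε < 1 by linarith))
    exact ⟨max N 1, fun n hn => ⟨(le_max_right _ _).trans hn, thetaZero_pt_ne ha hb h0 h1 n,
      hN n ((le_max_left _ _).trans hn)⟩⟩

omit ha hb h0 h1 in
theorem tendsto_ratio (j : ℕ) : Tendsto (fun n : ℕ =>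
    ‖((n / (n + 2 * j) : ℝ) : ℂ) ^ (1 / 2 - nu lg) * (Phi (zeroPt a b) ^ 4) ^ j - 1‖) atTop
    (𝓝 ‖(Phi (zeroPt a b) ^ 4) ^ j - 1‖) := by
  have := (((tendsto_ratio_cpow (1 / 2 - nu lg) j).mul_const
    ((Phi (zeroPt a b) ^ 4) ^ j)).sub_const 1).norm
  rwa [one_mul] at this

/-- Since `∞⁽⁰⁾` does not occur, failure at both indices means |1 - A| < ε twice. The factor between
the two values is unimodular because 1/2 - ν is purely imaginary. -/
theorem norm_ratio_sub_one_lt (hν : (nu lg).re = 1 / 2) (j : ℕ) {n : ℕ} (hn : 1 ≤ n)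
    (hn1 : n ∉ admissible a b ρ lg ε) (hn2 : n + 2 * j ∉ admissible a b ρ lg ε) :
    ‖((n / (n + 2 * j) : ℝ) : ℂ) ^ (1 / 2 - nu lg) * (Phi (zeroPt a b) ^ 4) ^ j - 1‖ < 2 * ε := by
  have hP : ‖Phi (zeroPt a b)‖ = 1 := by
    have := norm_Phi_originPt ha hb 1
    rwa [originPt, if_pos (by simp)] at this
  have hd : ∀ n, 1 ≤ n → n ∉ admissible a b ρ lg ε → ‖1 - A a b ρ lg n‖ < ε := fun n hn h => by
    by_contra! hle
    exact h ⟨hn, thetaZero_pt_ne ha hb h0 h1 n, hle⟩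
  refine norm_sub_one_lt ?_ (hd n hn hn1) ?_
  · rw [norm_mul, norm_ratio_cpow (by simp [hν]) j hn, norm_pow, norm_pow, hP]
    simp
  · rw [← A_add ha hb ρ lg hν j hn]
    exact hd _ (by omega) hn2

/-- If all large n failed, every power of Φ(𝟎)⁴ would lie, in the limit, within 2ε < 1 of 1; a
unimodular number other than 1 does not allow this. -/
theorem infinite_admissible (hε : ε < 1 / 2) (hν : (nu lg).re = 1 / 2) :
    (admissible a b ρ lg ε).Infinite := by
  intro hfin
  have hP : ‖Phi (zeroPt a b)‖ = 1 := by
    have := norm_Phi_originPt ha hb 1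
    rwa [originPt, if_pos (by simp)] at this
  have hne : Phi (zeroPt a b) ^ 4 ≠ 1 := by
    intro h
    have := norm_Phi_pow_sub_one ha hb
    rw [h, sub_self, norm_zero] at this
    have h2 : 0 < 2 * (2 * a * b / (a ^ 2 + b ^ 2)) := by positivity
    exact h2.ne this
  obtain ⟨j, hj⟩ := exists_one_le_norm_pow_sub_one (by rw [norm_pow, hP, one_pow]) hne
  obtain ⟨N, hN⟩ := hfin.bddAbove
  have hev : ∀ᶠ n : ℕ in atTop,
      ‖((n / (n + 2 * j) : ℝ) : ℂ) ^ (1 / 2 - nu lg) * (Phi (zeroPt a b) ^ 4) ^ j - 1‖ ≤ 2 * ε := by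
    filter_upwards [eventually_gt_atTop N, eventually_ge_atTop 1] with n hn hn1
    refine (norm_ratio_sub_one_lt ha hb h0 h1 hν j hn1 (ρ := ρ) (fun h => ?_) (fun h => ?_)).le
    · exact hn.not_ge (hN h)
    · have := hN h
      omega
  have := le_of_tendsto (tendsto_ratio (a := a) (b := b) (lg := lg) j) hev
  linarith

/-- From n to n + 2 the parity is kept and A is multiplied by nearly Φ(𝟎)⁴, whose distance 4ab/(a² +
b²) from 1 exceeds 2ε. -/
theorem exists_gap_le_two (hε : ε < 2 * a * b / (a ^ 2 + b ^ 2)) (hν : (nu lg).re = 1 / 2) :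
    ∃ n₀ : ℕ, ∀ n ≥ n₀, n ∈ admissible a b ρ lg ε ∨ n + 2 ∈ admissible a b ρ lg ε := by
  have ht := tendsto_ratio (a := a) (b := b) (lg := lg) 1
  rw [pow_one, norm_Phi_pow_sub_one ha hb] at ht
  obtain ⟨N, hN⟩ := eventually_atTop.1 (ht.eventually_const_le
    (show 2 * ε < 2 * (2 * a * b / (a ^ 2 + b ^ 2)) by linarith))
  refine ⟨max N 1, fun n hn => ?_⟩
  by_contra! h
  have h3 := norm_ratio_sub_one_lt ha hb h0 h1 hν 1 ((le_max_right N 1).trans hn) h.1 h.2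
  have h4 := hN n ((le_max_left N 1).trans hn)
  rw [pow_one] at h3
  exact h4.not_gt h3

end

end CrossOP

theorem mainTheorem4 (a b ε : ℝ) (ha : 0 < a) (hb : 0 < b) (hε : 0 < ε) (hε' : ε < 1 / 2)
    (ρ lg : Fin 4 → ℂ → ℂ)
    (hρ : CrossOP.IsWeight a b 1 ρ) (hlg : CrossOP.IsLogChoice a b ρ lg) :
    (CrossOP.admissible a b ρ lg ε).Nonempty ∧
    (CrossOP.JacEq a b (CrossOP.crho a b lg) 0 →
      CrossOP.admissible a b ρ lg ε = {n : ℕ | 1 ≤ n ∧ Even n}) ∧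
    (CrossOP.JacEq a b (CrossOP.crho a b lg) ((1 + CrossOP.B a b) / 2) →
      CrossOP.admissible a b ρ lg ε = {n : ℕ | Odd n}) ∧
    (¬ CrossOP.JacEq a b (CrossOP.crho a b lg) 0 →
      ¬ CrossOP.JacEq a b (CrossOP.crho a b lg) ((1 + CrossOP.B a b) / 2) →
      ((CrossOP.nu lg).re = 0 → CrossOP.admissible a b ρ lg ε = {n : ℕ | 1 ≤ n}) ∧
      (|(CrossOP.nu lg).re| < 1 / 2 → ∃ n₀ : ℕ, ∀ n ≥ n₀, n ∈ CrossOP.admissible a b ρ lg ε) ∧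
      ((CrossOP.nu lg).re = 1 / 2 →
        (CrossOP.admissible a b ρ lg ε).Infinite ∧
        (ε < 2 * a * b / (a ^ 2 + b ^ 2) → ∃ n₀ : ℕ, ∀ n ≥ n₀,
          n ∈ CrossOP.admissible a b ρ lg ε ∨ n + 1 ∈ CrossOP.admissible a b ρ lg ε ∨
            n + 2 ∈ CrossOP.admissible a b ρ lg ε))) := by
  refine ⟨?_, CrossOP.admissible_of_jacEq_zero ha hb hε', CrossOP.admissible_of_jacEq_half ha hb hε',
    fun h0 h1 => ⟨CrossOP.admissible_of_re_nu_eq_zero ha hb h0 h1 hε',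
      CrossOP.eventually_mem_admissible ha hb h0 h1 hε', fun hν =>
      ⟨CrossOP.infinite_admissible ha hb h0 h1 hε' hν, fun hε'' => ?_⟩⟩⟩
  · by_cases h0 : CrossOP.JacEq a b (CrossOP.crho a b lg) 0
    · rw [CrossOP.admissible_of_jacEq_zero ha hb hε' h0]
      exact ⟨2, by norm_num, even_two⟩
    by_cases h1 : CrossOP.JacEq a b (CrossOP.crho a b lg) ((1 + CrossOP.B a b) / 2)
    · rw [CrossOP.admissible_of_jacEq_half ha hb hε' h1]
      exact ⟨1, odd_one⟩
    -- The normalization excludes Re ν = -1/2, so outside the two special classes only Re ν = 1/2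
    -- needs the rotation argument.
    rcases hlg.nu_mem.2.lt_or_eq with hν | hν
    · obtain ⟨N, hN⟩ := CrossOP.eventually_mem_admissible ha hb h0 h1 hε' (ρ := ρ)
        (abs_lt.2 ⟨hlg.nu_mem.1, hν⟩)
      exact ⟨N, hN N le_rfl⟩
    · exact (CrossOP.infinite_admissible ha hb h0 h1 hε' hν).nonempty
  · obtain ⟨N, hN⟩ := CrossOP.exists_gap_le_two ha hb h0 h1 hε'' hν (ρ := ρ)
    exact ⟨N, fun n hn => (hN n hn).imp id Or.inr⟩
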